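/- Let $\ell^2=\ell^2(\mathbb Z)$ be the Hilbert space of square-summable functions $\mathbb Z\to\mathbb C$, with shifts $(S_\tau\psi)(t)=\psi(t-\tau)$, $\tau\in\mathbb Z$, and let $\delta\in\ell^2$ be the function with $\delta(0)=1$ and $\delta(t)=0$ for $t\ne 0$. The discrete-time Fourier transform of $\psi\in\ell^2$ is the $2\pi$-periodic function $\mathcal F_d[\psi](\omega)=\sum_{t\in\mathbb Z}\psi(t)e^{-i\omega t}$, where the series converges in the mean-square sense over a period; it is determined for almost every $\omega\in\mathbb R$. For finite sets $A,B$, a bounded linear map $D:\bigoplus_A\ell^2\to\bigoplus_B\ell^2$ is *linear shift-invariant* (LSI) if every component $\pi_bD\iota_a:\ell^2\to\ell^2$ commutes with all shifts. It is represented by the family of matrices $\widehat D_\omega=\big(\mathcal F_d[(\pi_bD\iota_a)\delta](\omega)\big)_{b\in B,a\in A}:\mathbb C^A\to\mathbb C^B$, $\omega\in\mathbb R$. The category $\mathbf{LSI}_\le$ has finite sets as objects. A morphism $f:A\to B$ is a family $\{\widehat f_\omega:\mathbb C^A\to\mathbb C^B\}_{\omega\in\mathbb R}$, taken up to equality for almost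 every $\omega$, that represents an LSI map $\bigoplus_A\ell^2\to\bigoplus_B\ell^2$ and for which $\widehat f_\omega$ is a contraction for the Euclidean norms, for almost every $\omega$. Composition and identities are computed at each $\omega$. The category is symmetric monoidal with $\oplus$ the disjoint union on objects and the direct sum at each $\omega$ on morphisms; the unit is $\varnothing$, and the associators $\alpha$, unitors $\lambda,\rho$ and symmetries $\sigma$ come from the evident bijections of sets. For a countable family $\{f_i\}_{i\in I}$ of morphisms $A\to B$ and a morphism $g:A\to B$, write $\Sigma\{f_i\}_{i\in I}=g$ if, for almost every $\omega$, the net of finite partial sums of $\{\widehat{(f_i)}_\omega\}_{i\in I}$ converges to $\widehat g_\omega$. For $f:A\oplus U\to B\oplus U$ let $f_{BA}:A\to B$, $f_{BU}:U\to B$, $f_{UA}:A\to U$, $f_{UU}:U\to U$ be its components $\pi_Yf\iota_X$, where the injections and projections are built from identities, zero morphisms and the unitors. **Theorem.** For all finite sets $A,B,U$ and every $f:A\oplus U\to B\oplus U$ in $\mathbf{LSI}_\le$ there is exactly one morphism $\mathrm{ex}^U(f):A\to B$ of $\mathbf{LSI}_\le$ with $$\mathrm{ex}^U(f)=\Sigma\big(\{f_{BA}\}\uplus\{f_{BU}f_{UU}^nf_{UA}\}_{n\in\mathbb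 N}\big),$$ and every LSI map $\bigoplus_A\ell^2\to\bigoplus_B\ell^2$ that $\mathrm{ex}^U(f)$ represents is a contraction. Moreover $(\mathbf{LSI}_\le,\oplus,\mathrm{ex})$ is a totally traced symmetric monoidal category, that is, $\mathrm{ex}$ satisfies * naturality: $h\,\mathrm{ex}^U(f)\,g=\mathrm{ex}^U\big((h\oplus\mathrm{id}_U)f(g\oplus\mathrm{id}_U)\big)$ for $f:A\oplus U\to B\oplus U$, $g:A'\to A$, $h:B\to B'$; * dinaturality: $\mathrm{ex}^U\big((\mathrm{id}_B\oplus g)f\big)=\mathrm{ex}^{U'}\big(f(\mathrm{id}_A\oplus g)\big)$ for $f:A\oplus U\to B\oplus U'$ and $g:U'\to U$; * superposing: $g\oplus\mathrm{ex}^U(f)=\mathrm{ex}^U\big(\alpha^{-1}(g\oplus f)\alpha\big)$ for $g:D\to E$ and $f:A\oplus U\to B\oplus U$; * vanishing: $\mathrm{ex}^{\varnothing}(f)=\rho_Bf\rho_A^{-1}$ for $f:A\oplus\varnothing\to B\oplus\varnothing$, and $\mathrm{ex}^U(\mathrm{ex}^V(f))=\mathrm{ex}^{U\oplus V}(\alpha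 f\alpha^{-1})$ for $f:(A\oplus U)\oplus V\to(B\oplus U)\oplus V$; * yanking: $\mathrm{ex}^U(\sigma_{U,U})=\mathrm{id}_U$. -/

import Mathlib

open CategoryTheory MonoidalCategory MeasureTheory
open scoped Real

universe u v

noncomputable section

namespace LSI

/-- The Hilbert space of square-summable functions `ℤ → ℂ`. -/
abbrev EllTwo : Type := lp (fun _ : ℤ => ℂ) 2

/-- The unit `δ` of the convolution. -/
def delta : EllTwo := lp.single 2 0 1

lemma memlp_shift (τ : ℤ) (ψ : EllTwo) : Memℓp (fun t : ℤ => ψ (t - τ)) 2 := by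
  have h := lp.memℓp ψ
  rw [memℓp_gen_iff (by norm_num)] at h ⊢
  exact (Equiv.subRight τ).summable_iff.2 h

/-- The shift operator `S_τ`, `(S_τ ψ)(t) = ψ(t - τ)`. -/
def shift (τ : ℤ) (ψ : EllTwo) : EllTwo := ⟨fun t => ψ (t - τ), memlp_shift τ ψ⟩

instance instTwoPiPos : Fact (0 < 2 * π) := ⟨Real.two_pi_pos⟩

lemma quasiMeasurePreserving_coe :
    Measure.QuasiMeasurePreserving (fun ω : ℝ => (ω : AddCircle (2 * π))) volume
      AddCircle.haarAddCircle := by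
  refine ⟨AddCircle.measurable_mk', ?_⟩
  refine Measure.AbsolutelyContinuous.mk fun s hs h0 => ?_
  rw [Measure.map_apply AddCircle.measurable_mk' hs]
  have h1 : (volume : Measure (AddCircle (2 * π))) s = 0 := by
    rw [AddCircle.volume_eq_smul_haarAddCircle]; simp [h0]
  have h2 : ∀ n : ℤ, volume ((fun ω : ℝ => (ω : AddCircle (2 * π))) ⁻¹' s ∩
      Set.Ioc (0 + n • (2 * π)) (0 + (n + 1) • (2 * π))) = 0 := by
    intro n
    have hp := AddCircle.measurePreserving_mk (2 * π) (n • (2 * π))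
    have := hp.measure_preimage hs.nullMeasurableSet
    rw [h1, Measure.restrict_apply (AddCircle.measurable_mk' hs)] at this
    convert! this using 3
    · rw [zero_add, zero_add, add_smul, one_smul]
  have h3 := iUnion_Ioc_add_zsmul Real.two_pi_pos 0
  rw [← Set.inter_univ ((fun ω : ℝ => (ω : AddCircle (2 * π))) ⁻¹' s), ← h3, Set.inter_iUnion]
  exact measure_iUnion_null h2

/-- Functions of the frequency `ω ∈ ℝ`, measurable and taken up to equality almost everywhere.
The DTFT of a square-summable function is only determined almost everywhere. -/
abbrev Freq : Type := ℝ →ₘ[volume] ℂ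

instance instCommRingFreq : CommRing Freq :=
  { (inferInstance : AddCommGroup Freq), (inferInstance : CommMonoid Freq) with
    left_distrib := fun a b c => AEEqFun.toGerm_injective (by
      simp only [AEEqFun.mul_toGerm, AEEqFun.add_toGerm, mul_add])
    right_distrib := fun a b c => AEEqFun.toGerm_injective (by
      simp only [AEEqFun.mul_toGerm, AEEqFun.add_toGerm, add_mul])
    zero_mul := fun a => AEEqFun.toGerm_injective (by
      simp only [AEEqFun.mul_toGerm, AEEqFun.zero_toGerm, zero_mul])
    mul_zero := fun a => AEEqFun.toGerm_injective (by
      simp only [AEEqFun.mul_toGerm, AEEqFun.zero_toGerm, mul_zero]) }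

/-- The orthonormal basis `ω ↦ e^{-iωt}`, `t ∈ ℤ`, of square-integrable functions on a period,
for the normalised measure `dω / 2π`. -/
def expBasis : HilbertBasis ℤ ℂ (Lp ℂ 2 (AddCircle.haarAddCircle (T := 2 * π))) :=
  HilbertBasis.mk (v := fun t : ℤ => fourierLp 2 (-t))
    (orthonormal_fourier.comp _ neg_injective)
    (by
      have h : Set.range (fun t : ℤ => fourierLp (T := 2 * π) 2 (-t)) =
          Set.range (fourierLp (T := 2 * π) 2) :=
        (Equiv.neg ℤ).surjective.range_comp (fourierLp (T := 2 * π) 2)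
      rw [h]
      exact (span_fourierLp_closure_eq_top (by norm_num)).ge)

/-- The discrete-time Fourier transform `∑ₜ f(t) e^{-iωt}`, as a square-integrable function on a
period; the series converges in the mean-square sense, see `hasSum_dtftCircle`. -/
def dtftCircle : EllTwo ≃ₗᵢ[ℂ] Lp ℂ 2 (AddCircle.haarAddCircle (T := 2 * π)) :=
  expBasis.repr.symm

lemma hasSum_dtftCircle (f : EllTwo) :
    HasSum (fun t : ℤ => f t • fourierLp (T := 2 * π) 2 (-t)) (dtftCircle f) := by
  have := expBasis.hasSum_repr_symm f
  simpa only [expBasis, HilbertBasis.coe_mk] using! this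

/-- The discrete-time Fourier transform `𝓕_d[f](ω) = ∑ₜ f(t) e^{-iωt}`, as a `2π`-periodic
function of `ω ∈ ℝ`. -/
def dtft (f : EllTwo) : Freq :=
  (dtftCircle f : AddCircle (2 * π) →ₘ[AddCircle.haarAddCircle] ℂ).compQuasiMeasurePreserving
    (fun ω : ℝ => (ω : AddCircle (2 * π))) quasiMeasurePreserving_coe

lemma dtft_ae (f : EllTwo) : dtft f =ᵐ[volume] fun ω : ℝ => dtftCircle f (ω : AddCircle (2 * π)) :=
  AEEqFun.coeFn_compQuasiMeasurePreserving _ quasiMeasurePreserving_coe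

lemma dtft_eq_of_circle {f : EllTwo} {F : ℝ → ℂ} {g : Freq} (hg : g =ᵐ[volume] F)
    (G : AddCircle (2 * π) → ℂ) (hF : ∀ ω : ℝ, F ω = G ω)
    (h : dtftCircle f =ᵐ[AddCircle.haarAddCircle] G) : dtft f = g := by
  refine AEEqFun.ext ((dtft_ae f).trans ?_)
  filter_upwards [quasiMeasurePreserving_coe.ae_eq_comp h, hg] with ω h1 h2
  rw [h2, hF]; exact h1

lemma dtftCircle_single (t : ℤ) : dtftCircle (lp.single 2 t 1) = fourierLp 2 (-t) :=
  (HilbertBasis.repr_symm_single expBasis t).trans (congr_fun (HilbertBasis.coe_mk _ _) t)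

lemma dtft_delta : dtft delta = 1 := by
  have h : dtftCircle delta = fourierLp 2 0 := dtftCircle_single 0
  refine dtft_eq_of_circle (F := fun _ => 1) (AEEqFun.coeFn_one) (fun _ => 1) (fun _ => rfl) ?_
  rw [h]
  filter_upwards [coeFn_fourierLp (T := 2 * π) 2 0] with x hx
  rw [hx]; simp

lemma dtft_add (f g : EllTwo) : dtft (f + g) = dtft f + dtft g := by
  refine AEEqFun.ext ?_
  have h : dtftCircle (f + g) = dtftCircle f + dtftCircle g := map_add _ _ _
  filter_upwards [dtft_ae (f + g), dtft_ae f, dtft_ae g, AEEqFun.coeFn_add (dtft f) (dtft g),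
    quasiMeasurePreserving_coe.ae_eq_comp (Lp.coeFn_add (dtftCircle f) (dtftCircle g))]
    with ω h1 h2 h3 h4 h5
  rw [h1, h, h4, Pi.add_apply, h2, h3]; exact h5

lemma dtft_zero : dtft 0 = 0 := by
  simpa using dtft_add 0 0

/-- A map on `ℓ²` is shift invariant when it commutes with every shift operator. -/
def IsShiftInvariant (K : EllTwo → EllTwo) : Prop :=
  ∀ (τ : ℤ) (ψ : EllTwo), K (shift τ ψ) = shift τ (K ψ)

lemma shift_delta (τ : ℤ) : shift τ delta = lp.single 2 τ 1 := by
  ext t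
  simp only [shift, delta, lp.single_apply, Pi.single_apply]
  simp [sub_eq_zero]

lemma shift_add (τ : ℤ) (f g : EllTwo) : shift τ (f + g) = shift τ f + shift τ g := by
  ext t; rfl

/-- Multiplication of square-integrable functions on a period, with integrable result. -/
def mulL1 : Lp ℂ 2 (AddCircle.haarAddCircle (T := 2 * π)) →L[ℂ]
    Lp ℂ 2 (AddCircle.haarAddCircle (T := 2 * π)) →L[ℂ]
    Lp ℂ 1 (AddCircle.haarAddCircle (T := 2 * π)) :=
  (ContinuousLinearMap.mul ℂ ℂ).holderL AddCircle.haarAddCircle 2 2 1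

lemma mulL1_ae (f g : Lp ℂ 2 (AddCircle.haarAddCircle (T := 2 * π))) :
    mulL1 f g =ᵐ[AddCircle.haarAddCircle] fun x => f x * g x := by
  have := (ContinuousLinearMap.mul ℂ ℂ).coeFn_holder (r := 1) f g
  simpa [mulL1] using! this

lemma shift_single (τ s : ℤ) (c : ℂ) :
    shift τ (lp.single 2 s c) = lp.single 2 (s + τ) c := by
  ext t
  simp only [shift, lp.single_apply, Pi.single_apply]
  simp [sub_eq_iff_eq_add]

lemma shift_smul (τ : ℤ) (c : ℂ) (f : EllTwo) : shift τ (c • f) = c • shift τ f := by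
  ext t; rfl

lemma norm_shift (τ : ℤ) (f : EllTwo) : ‖shift τ f‖ = ‖f‖ := by
  rw [lp.norm_eq_tsum_rpow (by norm_num), lp.norm_eq_tsum_rpow (by norm_num)]
  congr 1
  exact (Equiv.subRight τ).tsum_eq (fun t => ‖f t‖ ^ (2 : ENNReal).toReal)

def shiftL (τ : ℤ) : EllTwo →L[ℂ] EllTwo :=
  LinearMap.mkContinuous ⟨⟨shift τ, shift_add τ⟩, fun c f => shift_smul τ c f⟩ 1
    (fun f => by simp [norm_shift])

lemma mulL1_shift (τ : ℤ) (f : EllTwo) :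
    mulL1 (fourierLp 2 0) (dtftCircle (shift τ f)) = mulL1 (fourierLp 2 (-τ)) (dtftCircle f) := by
  suffices h : (mulL1 (fourierLp 2 0)) ∘L
      (dtftCircle.toContinuousLinearEquiv : EllTwo →L[ℂ] _) ∘L (shiftL τ) =
      (mulL1 (fourierLp 2 (-τ))) ∘L (dtftCircle.toContinuousLinearEquiv : EllTwo →L[ℂ] _) from
    DFunLike.congr_fun h f
  refine lp.ext_continuousLinearMap (by norm_num) fun s => ?_
  ext1
  change mulL1 (fourierLp 2 0) (dtftCircle (shift τ (lp.single 2 s 1))) =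
    mulL1 (fourierLp 2 (-τ)) (dtftCircle (lp.single 2 s 1))
  rw [shift_single, dtftCircle_single, dtftCircle_single]
  refine Lp.ext ?_
  filter_upwards [mulL1_ae (fourierLp 2 0) (fourierLp 2 (-(s + τ))),
    mulL1_ae (fourierLp 2 (-τ)) (fourierLp 2 (-s)), coeFn_fourierLp (T := 2 * π) 2 0,
    coeFn_fourierLp (T := 2 * π) 2 (-(s + τ)), coeFn_fourierLp (T := 2 * π) 2 (-τ),
    coeFn_fourierLp (T := 2 * π) 2 (-s)] with x h1 h2 h3 h4 h5 h6
  rw [h1, h2, h3, h4, h5, h6, ← fourier_add, ← fourier_add]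
  congr 2; ring

/-- The convolution theorem for a bounded shift invariant operator. -/
lemma dtft_apply (K : EllTwo →L[ℂ] EllTwo) (hK : IsShiftInvariant K) (ψ : EllTwo) :
    dtft (K ψ) = dtft (K delta) * dtft ψ := by
  have key : mulL1 (fourierLp 2 0) (dtftCircle (K ψ)) =
      mulL1 (dtftCircle (K delta)) (dtftCircle ψ) := by
    suffices h : (mulL1 (fourierLp 2 0)) ∘L
        (dtftCircle.toContinuousLinearEquiv : EllTwo →L[ℂ] _) ∘L K =
        (mulL1 (dtftCircle (K delta))) ∘L
          (dtftCircle.toContinuousLinearEquiv : EllTwo →L[ℂ] _) from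
      DFunLike.congr_fun h ψ
    refine lp.ext_continuousLinearMap (by norm_num) fun s => ?_
    ext1
    change mulL1 (fourierLp 2 0) (dtftCircle (K (lp.single 2 s 1))) =
      mulL1 (dtftCircle (K delta)) (dtftCircle (lp.single 2 s 1))
    rw [← shift_delta, hK, mulL1_shift, shift_delta, dtftCircle_single]
    refine Lp.ext ?_
    filter_upwards [mulL1_ae (fourierLp 2 (-s)) (dtftCircle (K delta)),
      mulL1_ae (dtftCircle (K delta)) (fourierLp 2 (-s))] with x h1 h2
    rw [h1, h2, mul_comm]
  refine dtft_eq_of_circle (F := fun ω : ℝ => dtftCircle (K delta) ω * dtftCircle ψ ω) ?_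
    (fun x => dtftCircle (K delta) x * dtftCircle ψ x) (fun _ => rfl) ?_
  · filter_upwards [AEEqFun.coeFn_mul (dtft (K delta)) (dtft ψ), dtft_ae (K delta), dtft_ae ψ]
      with ω h1 h2 h3
    rw [h1, Pi.mul_apply, h2, h3]
  · filter_upwards [mulL1_ae (fourierLp 2 0) (dtftCircle (K ψ)),
      mulL1_ae (dtftCircle (K delta)) (dtftCircle ψ), coeFn_fourierLp (T := 2 * π) 2 0]
      with x h1 h2 h3
    rw [← h2, ← key, h1, h3]; simp


/-- The direct sum `⊕_A ℓ²`. -/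
abbrev SumEllTwo (A : Type u) [Fintype A] : Type u := PiLp 2 (fun _ : A => EllTwo)

/-- The injection `ι_a : ℓ² → ⊕_A ℓ²`. -/
def inj {A : Type u} [Fintype A] [DecidableEq A] (a : A) : EllTwo →L[ℂ] SumEllTwo A :=
  ((PiLp.continuousLinearEquiv 2 ℂ (fun _ : A => EllTwo)).symm :
    (A → EllTwo) →L[ℂ] SumEllTwo A) ∘L ContinuousLinearMap.single ℂ (fun _ : A => EllTwo) a

/-- The component `π_b D ι_a : ℓ² → ℓ²` of a map `D : ⊕_A ℓ² → ⊕_B ℓ²`. -/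
def component {A B : Type u} [Fintype A] [DecidableEq A] [Fintype B]
    (D : SumEllTwo A →L[ℂ] SumEllTwo B) (b : B) (a : A) : EllTwo →L[ℂ] EllTwo :=
  PiLp.proj 2 (fun _ : B => EllTwo) b ∘L D ∘L inj a

/-- Linear shift invariant maps `⊕_A ℓ² → ⊕_B ℓ²`. -/
def IsLSI {A B : Type u} [Fintype A] [DecidableEq A] [Fintype B]
    (D : SumEllTwo A →L[ℂ] SumEllTwo B) : Prop :=
  ∀ b a, IsShiftInvariant (component D b a)

/-- The frequency-domain representation `D̂ = {𝓕_d[χ_{ba}]}` of `D`, where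
`χ_{ba} = (π_b D ι_a)[δ]`. -/
def hatOf {A B : Type u} [Fintype A] [DecidableEq A] [Fintype B]
    (D : SumEllTwo A →L[ℂ] SumEllTwo B) : Matrix B A Freq :=
  Matrix.of fun b a => dtft (component D b a delta)

/-- The member at frequency `ω` of a frequency-indexed family of matrices. -/
def evalAt {A B : Type u} (M : Matrix B A Freq) (ω : ℝ) : Matrix B A ℂ :=
  M.map fun x => x ω

/-- The linear map `ℂ^A → ℂ^B` given by the matrix is a contraction for the Euclidean norms. -/
def IsContraction {A B : Type u} [Fintype A] [DecidableEq A] [Fintype B]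
    (M : Matrix B A ℂ) : Prop :=
  ∀ v : EuclideanSpace ℂ A, ‖Matrix.toEuclideanLin M v‖ ≤ ‖v‖

/-- Objects of the category `LSI_≤`: finite sets. -/
structure Obj : Type (u + 1) where
  carrier : Type u
  [fintype : Fintype carrier]
  [decidableEq : DecidableEq carrier]

attribute [instance] Obj.fintype Obj.decidableEq

instance : CoeSort Obj.{u} (Type u) := ⟨Obj.carrier⟩

/-- Morphisms `A → B` of `LSI_≤`: linear shift invariant maps `⊕_A ℓ² → ⊕_B ℓ²`, represented as
families `{f̂_ω : ℂ^A → ℂ^B}` indexed by `ω ∈ ℝ`, whose members are contractions. -/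
@[ext]
structure Hom (A B : Obj.{u}) : Type u where
  hat : Matrix B A Freq
  exists_lsi : ∃ D : SumEllTwo A →L[ℂ] SumEllTwo B, IsLSI D ∧ hatOf D = hat
  contraction : ∀ᵐ ω : ℝ, IsContraction (evalAt hat ω)

/-- Transforms of the characteristic functions of bounded shift invariant maps on `ℓ²`. -/
def IsEntry (m : Freq) : Prop :=
  ∃ K : EllTwo →L[ℂ] EllTwo, IsShiftInvariant K ∧ dtft (K delta) = m

lemma IsEntry.zero : IsEntry 0 :=
  ⟨0, fun _ _ => by ext t; rfl, by simpa using dtft_zero⟩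

lemma IsEntry.one : IsEntry 1 :=
  ⟨ContinuousLinearMap.id ℂ _, fun _ _ => rfl, dtft_delta⟩

lemma IsEntry.add {m n : Freq} (hm : IsEntry m) (hn : IsEntry n) : IsEntry (m + n) := by
  obtain ⟨K, hK, rfl⟩ := hm
  obtain ⟨L, hL, rfl⟩ := hn
  refine ⟨K + L, fun τ ψ => ?_, ?_⟩
  · simp only [add_apply, hK τ ψ, hL τ ψ, shift_add]
  · rw [← dtft_add]; rfl

lemma IsEntry.mul {m n : Freq} (hm : IsEntry m) (hn : IsEntry n) : IsEntry (m * n) := by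
  obtain ⟨K, hK, rfl⟩ := hm
  obtain ⟨L, hL, rfl⟩ := hn
  refine ⟨K ∘L L, fun τ ψ => ?_, ?_⟩
  · simp only [ContinuousLinearMap.comp_apply, hL τ ψ, hK τ (L ψ)]
  · exact dtft_apply K hK (L delta)

lemma IsEntry.sum {ι : Type u} (s : Finset ι) {m : ι → Freq} (hm : ∀ i, IsEntry (m i)) :
    IsEntry (∑ i ∈ s, m i) := by
  classical
  induction s using Finset.induction_on with
  | empty => simpa using IsEntry.zero
  | insert i s hi ih => rw [Finset.sum_insert hi]; exact (hm i).add ih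

section

set_option linter.unusedSectionVars false

variable {A B C D : Type u} [Fintype A] [DecidableEq A] [Fintype B] [DecidableEq B]
  [Fintype C] [DecidableEq C] [Fintype D] [DecidableEq D]

/-- The map `⊕_A ℓ² → ⊕_B ℓ²` with prescribed components. -/
def ofComponents (K : B → A → EllTwo →L[ℂ] EllTwo) : SumEllTwo A →L[ℂ] SumEllTwo B :=
  ((PiLp.continuousLinearEquiv 2 ℂ (fun _ : B => EllTwo)).symm :
    (B → EllTwo) →L[ℂ] SumEllTwo B) ∘L
    ContinuousLinearMap.pi fun b => ∑ a, K b a ∘L PiLp.proj 2 (fun _ : A => EllTwo) a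

lemma component_ofComponents (K : B → A → EllTwo →L[ℂ] EllTwo) (b : B) (a : A) :
    component (ofComponents K) b a = K b a := by
  ext1 ψ
  have h : ∀ a', (inj a ψ : SumEllTwo A) a' = if a' = a then ψ else 0 := by
    intro a'
    exact Pi.single_apply a ψ a'
  change (∑ a', K b a' ∘L PiLp.proj 2 (fun _ : A => EllTwo) a') (inj a ψ) = K b a ψ
  rw [sum_apply, Finset.sum_eq_single a]
  · simp [h]
  · intro a' _ ha'; simp [h, ha']
  · simp

lemma exists_lsi_iff (M : Matrix B A Freq) :
    (∃ D : SumEllTwo A →L[ℂ] SumEllTwo B, IsLSI D ∧ hatOf D = M) ↔ ∀ b a, IsEntry (M b a) := by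
  constructor
  · rintro ⟨D, hD, rfl⟩ b a
    exact ⟨component D b a, hD b a, rfl⟩
  · intro h
    choose K hK hKM using h
    refine ⟨ofComponents K, fun b a => ?_, ?_⟩
    · rw [component_ofComponents]; exact hK b a
    · ext1 b a
      rw [← hKM b a, ← component_ofComponents K b a]; rfl

lemma isContraction_one : IsContraction (1 : Matrix A A ℂ) := by
  intro v
  simp [Matrix.toLpLin_one]

lemma isContraction_zero : IsContraction (0 : Matrix B A ℂ) := by
  intro v; simp

lemma IsContraction.mul {M : Matrix C B ℂ} {N : Matrix B A ℂ} (hM : IsContraction M)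
    (hN : IsContraction N) : IsContraction (M * N) := by
  intro v
  have : Matrix.toEuclideanLin (M * N) v =
      Matrix.toEuclideanLin M (Matrix.toEuclideanLin N v) := by
    ext i; simp [Matrix.toLpLin_apply, Matrix.mulVec_mulVec]
  rw [this]
  exact (hM _).trans (hN _)

lemma isContraction_iff (M : Matrix B A ℂ) :
    IsContraction M ↔ ∀ v : A → ℂ, ∑ b, ‖(M.mulVec v) b‖ ^ 2 ≤ ∑ a, ‖v a‖ ^ 2 := by
  constructor
  · intro h v
    have := h (WithLp.toLp 2 v)
    rw [EuclideanSpace.norm_eq, EuclideanSpace.norm_eq] at this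
    exact (Real.sqrt_le_sqrt_iff (by positivity)).1 this
  · intro h v
    rw [EuclideanSpace.norm_eq, EuclideanSpace.norm_eq]
    exact Real.sqrt_le_sqrt (h v.ofLp)

lemma IsContraction.fromBlocks {M : Matrix C A ℂ} {N : Matrix D B ℂ} (hM : IsContraction M)
    (hN : IsContraction N) : IsContraction (Matrix.fromBlocks M 0 0 N) := by
  rw [isContraction_iff] at *
  intro v
  rw [Matrix.fromBlocks_mulVec, Fintype.sum_sum_type, Fintype.sum_sum_type]
  simpa using add_le_add (hM (v ∘ Sum.inl)) (hN (v ∘ Sum.inr))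

/-- The permutation matrix of a bijection. -/
def permMatrix (R : Type) [Zero R] [One R] (e : A ≃ B) : Matrix B A R :=
  Matrix.of fun b a => if e a = b then 1 else 0

lemma isContraction_perm (e : A ≃ B) : IsContraction (permMatrix ℂ e) := by
  rw [isContraction_iff]
  intro v
  have h : ∀ b, (permMatrix ℂ e).mulVec v b = v (e.symm b) := by
    intro b
    simp [permMatrix, Matrix.mulVec, dotProduct, ← Equiv.eq_symm_apply]
  simp only [h]
  exact (e.symm.sum_comp (fun a => ‖v a‖ ^ 2)).le

lemma evalAt_mul (M : Matrix C B Freq) (N : Matrix B A Freq) :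
    ∀ᵐ ω : ℝ, evalAt (M * N) ω = evalAt M ω * evalAt N ω := by
  have hs : ∀ (s : Finset B) (c : C) (a : A), ∀ᵐ ω : ℝ,
      (∑ b ∈ s, M c b * N b a : Freq) ω = ∑ b ∈ s, M c b ω * N b a ω := by
    intro s c a
    classical
    induction s using Finset.induction_on with
    | empty =>
      filter_upwards [AEEqFun.coeFn_zero (α := ℝ) (β := ℂ) (μ := volume)] with ω h
      simp [h]
    | insert b s hb ih =>
      filter_upwards [ih, AEEqFun.coeFn_add (M c b * N b a) (∑ b ∈ s, M c b * N b a),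
        AEEqFun.coeFn_mul (M c b) (N b a)] with ω h1 h2 h3
      rw [Finset.sum_insert hb, Finset.sum_insert hb, h2, Pi.add_apply, h1, h3, Pi.mul_apply]
  filter_upwards [ae_all_iff.2 fun c => ae_all_iff.2 fun a => hs Finset.univ c a] with ω h
  ext c a
  exact h c a

lemma evalAt_zero : ∀ᵐ ω : ℝ, evalAt (0 : Matrix B A Freq) ω = 0 := by
  filter_upwards [AEEqFun.coeFn_zero (α := ℝ) (β := ℂ) (μ := volume)] with ω h
  ext b a
  exact h

lemma evalAt_perm (e : A ≃ B) : ∀ᵐ ω : ℝ, evalAt (permMatrix Freq e) ω = permMatrix ℂ e := by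
  filter_upwards [AEEqFun.coeFn_zero (α := ℝ) (β := ℂ) (μ := volume),
    AEEqFun.coeFn_one (α := ℝ) (β := ℂ) (μ := volume)] with ω h0 h1
  ext b a
  by_cases h : e a = b
  · simp [evalAt, permMatrix, h, h1]
  · simp [evalAt, permMatrix, h, h0]

lemma evalAt_fromBlocks (M : Matrix C A Freq) (N : Matrix D B Freq) :
    ∀ᵐ ω : ℝ, evalAt (Matrix.fromBlocks M 0 0 N) ω =
      Matrix.fromBlocks (evalAt M ω) 0 0 (evalAt N ω) := by
  filter_upwards [AEEqFun.coeFn_zero (α := ℝ) (β := ℂ) (μ := volume)] with ω h0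
  ext i j
  rcases i with i | i <;> rcases j with j | j <;> simp [evalAt, h0]

end

/-- Composition: matrix multiplication, that is, composition at each frequency. -/
def Hom.comp {A B C : Obj.{u}} (f : Hom A B) (g : Hom B C) : Hom A C where
  hat := g.hat * f.hat
  exists_lsi := (exists_lsi_iff _).2 fun c a => IsEntry.sum _ fun b =>
    ((exists_lsi_iff _).1 g.exists_lsi c b).mul ((exists_lsi_iff _).1 f.exists_lsi b a)
  contraction := by
    filter_upwards [f.contraction, g.contraction, evalAt_mul g.hat f.hat] with ω hf hg h
    rw [h]; exact hg.mul hf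

/-- The morphism given at every frequency by the permutation matrix of a bijection. -/
def ofEquiv {A B : Obj.{u}} (e : A ≃ B) : Hom A B where
  hat := permMatrix Freq e
  exists_lsi := (exists_lsi_iff _).2 fun b a => by
    by_cases h : e a = b
    · simpa [permMatrix, h] using IsEntry.one
    · simpa [permMatrix, h] using IsEntry.zero
  contraction := by
    filter_upwards [evalAt_perm e] with ω h
    rw [h]; exact isContraction_perm e

/-- The zero morphism. -/
def zeroHom (A B : Obj.{u}) : Hom A B where
  hat := 0
  exists_lsi := (exists_lsi_iff _).2 fun _ _ => IsEntry.zero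
  contraction := by
    filter_upwards [evalAt_zero (A := A.carrier) (B := B.carrier)] with ω h
    rw [h]; exact isContraction_zero

lemma comp_hat {A B C : Obj.{u}} (f : Hom A B) (g : Hom B C) :
    (f.comp g).hat = g.hat * f.hat := rfl

lemma ofEquiv_comp_hat {A B C : Obj.{u}} (e : A ≃ B) (f : Hom B C) (c : C) (a : A) :
    ((ofEquiv e).comp f).hat c a = f.hat c (e a) := by
  simp [comp_hat, ofEquiv, permMatrix, Matrix.mul_apply]

lemma comp_ofEquiv_hat {A B C : Obj.{u}} (f : Hom A B) (e : B ≃ C) (c : C) (a : A) :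
    (f.comp (ofEquiv e)).hat c a = f.hat (e.symm c) a := by
  simp [comp_hat, ofEquiv, permMatrix, Matrix.mul_apply, ← Equiv.eq_symm_apply]

/-- Composition is matrix multiplication at each frequency, and the identity is the identity
matrix at each frequency. -/
instance instCategory : Category.{u} Obj.{u} where
  Hom := Hom
  id A := ofEquiv (Equiv.refl A)
  comp := Hom.comp
  id_comp f := Hom.ext (Matrix.ext fun c a => ofEquiv_comp_hat _ f c a)
  comp_id f := Hom.ext (Matrix.ext fun c a => comp_ofEquiv_hat f _ c a)
  assoc _ _ _ := Hom.ext (Matrix.mul_assoc _ _ _).symm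

/-- The morphism given at every frequency by the permutation matrix of a bijection. -/
def homOfEquiv {A B : Obj.{u}} (e : A ≃ B) : A ⟶ B := ofEquiv e

lemma hom_ext {A B : Obj.{u}} {f g : A ⟶ B} (h : ∀ b a, f.hat b a = g.hat b a) : f = g :=
  Hom.ext (Matrix.ext h)

lemma homOfEquiv_hat {A B : Obj.{u}} (e : A ≃ B) (b : B) (a : A) :
    (homOfEquiv e).hat b a = if e a = b then 1 else 0 := rfl

lemma homOfEquiv_refl (A : Obj.{u}) : homOfEquiv (Equiv.refl A) = 𝟙 A := rfl

lemma homOfEquiv_comp_hat {A B C : Obj.{u}} (e : A ≃ B) (f : B ⟶ C) (c : C) (a : A) :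
    (homOfEquiv e ≫ f).hat c a = f.hat c (e a) := ofEquiv_comp_hat e f c a

lemma comp_homOfEquiv_hat {A B C : Obj.{u}} (f : A ⟶ B) (e : B ≃ C) (c : C) (a : A) :
    (f ≫ homOfEquiv e).hat c a = f.hat (e.symm c) a := comp_ofEquiv_hat f e c a

lemma homOfEquiv_trans {A B C : Obj.{u}} (e : A ≃ B) (e' : B ≃ C) :
    homOfEquiv e ≫ homOfEquiv e' = homOfEquiv (e.trans e') :=
  hom_ext fun c a => by rw [homOfEquiv_comp_hat]; rfl

/-- The isomorphism given at every frequency by a permutation matrix. -/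
def isoOfEquiv {A B : Obj.{u}} (e : A ≃ B) : A ≅ B where
  hom := homOfEquiv e
  inv := homOfEquiv e.symm
  hom_inv_id := by rw [homOfEquiv_trans, Equiv.self_trans_symm]; rfl
  inv_hom_id := by rw [homOfEquiv_trans, Equiv.symm_trans_self]; rfl

/-- The disjoint union of finite sets. -/
def sumObj (A B : Obj.{u}) : Obj.{u} := ⟨A ⊕ B⟩

/-- The empty set. -/
def emptyObj : Obj.{u} := ⟨PEmpty.{u + 1}⟩

instance instIsEmptyEmptyObj : IsEmpty emptyObj.{u} := inferInstanceAs (IsEmpty PEmpty.{u + 1})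

/-- The direct sum of morphisms, computed at each frequency. -/
def sumHom {A B C D : Obj.{u}} (f : A ⟶ C) (g : B ⟶ D) : sumObj A B ⟶ sumObj C D where
  hat := Matrix.fromBlocks f.hat 0 0 g.hat
  exists_lsi := (exists_lsi_iff _).2 fun i j => by
    rcases i with i | i <;> rcases j with j | j
    · exact (exists_lsi_iff _).1 f.exists_lsi i j
    · exact IsEntry.zero
    · exact IsEntry.zero
    · exact (exists_lsi_iff _).1 g.exists_lsi i j
  contraction := by
    filter_upwards [f.contraction, g.contraction, evalAt_fromBlocks f.hat g.hat] with ω hf hg h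
    exact h ▸ hf.fromBlocks hg

/-- The disjoint union of two bijections. -/
def sumEquiv {A B C D : Obj.{u}} (e : A ≃ C) (e' : B ≃ D) : sumObj A B ≃ sumObj C D :=
  Equiv.sumCongr e e'

lemma sumHom_homOfEquiv {A B C D : Obj.{u}} (e : A ≃ C) (e' : B ≃ D) :
    sumHom (homOfEquiv e) (homOfEquiv e') = homOfEquiv (sumEquiv e e') :=
  hom_ext fun i j => by
    rw [homOfEquiv_hat]
    rcases i with i | i <;> rcases j with j | j
    · by_cases h : e j = i
      · exact (if_pos h).trans (if_pos (congrArg Sum.inl h)).symm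
      · exact (if_neg h).trans (if_neg fun h' => h (Sum.inl_injective h')).symm
    · exact (if_neg Sum.inr_ne_inl).symm
    · exact (if_neg Sum.inl_ne_inr).symm
    · by_cases h : e' j = i
      · exact (if_pos h).trans (if_pos (congrArg Sum.inr h)).symm
      · exact (if_neg h).trans (if_neg fun h' => h (Sum.inr_injective h')).symm

lemma homOfEquiv_congr {A B : Obj.{u}} {e e' : A ≃ B} (h : ∀ a, e a = e' a) :
    homOfEquiv e = homOfEquiv e' := by
  rw [Equiv.ext h]

lemma sumHom_comp {A B C A' B' C' : Obj.{u}} (f : A ⟶ B) (g : B ⟶ C) (f' : A' ⟶ B')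
    (g' : B' ⟶ C') : sumHom (f ≫ g) (f' ≫ g') = sumHom f f' ≫ sumHom g g' :=
  Hom.ext (by
    change Matrix.fromBlocks (g.hat * f.hat) 0 0 (g'.hat * f'.hat) =
      Matrix.fromBlocks g.hat 0 0 g'.hat * Matrix.fromBlocks f.hat 0 0 f'.hat
    rw [Matrix.fromBlocks_multiply]; simp)

/-- The associativity bijection. -/
def assocEquiv (A B C : Obj.{u}) : sumObj (sumObj A B) C ≃ sumObj A (sumObj B C) :=
  Equiv.sumAssoc A B C

/-- The left unit bijection. -/
def leftEquiv (A : Obj.{u}) : sumObj emptyObj A ≃ A := Equiv.emptySum emptyObj A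

/-- The right unit bijection. -/
def rightEquiv (A : Obj.{u}) : sumObj A emptyObj ≃ A := Equiv.sumEmpty A emptyObj

/-- The bijection that exchanges the two summands. -/
def commEquiv (A B : Obj.{u}) : sumObj A B ≃ sumObj B A := Equiv.sumComm A B

instance instMonoidalStruct : MonoidalCategoryStruct Obj.{u} where
  tensorObj := sumObj
  tensorUnit := emptyObj
  tensorHom := sumHom
  whiskerLeft A _ _ f := sumHom (𝟙 A) f
  whiskerRight f B := sumHom f (𝟙 B)
  associator A B C := isoOfEquiv (assocEquiv A B C)
  leftUnitor A := isoOfEquiv (leftEquiv A)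
  rightUnitor A := isoOfEquiv (rightEquiv A)

/-- The monoidal category with the disjoint union of finite sets, the direct sum of morphisms and
the empty set as unit. -/
instance instMonoidal : MonoidalCategory Obj.{u} := MonoidalCategory.ofTensorHom
  (id_tensorHom_id := fun A B => by
    refine (sumHom_homOfEquiv (Equiv.refl A) (Equiv.refl B)).trans (homOfEquiv_congr ?_)
    rintro (a | a) <;> rfl)
  (id_tensorHom := fun _ _ _ _ => rfl)
  (tensorHom_id := fun _ _ => rfl)
  (tensorHom_comp_tensorHom := fun f₁ f₂ g₁ g₂ => (sumHom_comp f₁ g₁ f₂ g₂).symm)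
  (associator_naturality := fun {A B C A' B' C'} f g h => hom_ext fun i j => by
    refine (comp_homOfEquiv_hat _ (assocEquiv A' B' C') i j).trans
      (Eq.trans ?_ (homOfEquiv_comp_hat (assocEquiv A B C) _ i j).symm)
    rcases i with i | i | i <;> rcases j with (j | j) | j <;> rfl)
  (leftUnitor_naturality := fun {A B} f => hom_ext fun i j => by
    refine (comp_homOfEquiv_hat _ (leftEquiv B) i j).trans
      (Eq.trans ?_ (homOfEquiv_comp_hat (leftEquiv A) _ i j).symm)
    rcases j with j | j
    · exact PEmpty.elim j
    · rfl)
  (rightUnitor_naturality := fun {A B} f => hom_ext fun i j => by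
    refine (comp_homOfEquiv_hat _ (rightEquiv B) i j).trans
      (Eq.trans ?_ (homOfEquiv_comp_hat (rightEquiv A) _ i j).symm)
    rcases j with j | j
    · rfl
    · exact PEmpty.elim j)
  (pentagon := fun A B C D => by
    change sumHom (homOfEquiv (assocEquiv A B C)) (homOfEquiv (Equiv.refl D)) ≫
      homOfEquiv (assocEquiv A (sumObj B C) D) ≫
        sumHom (homOfEquiv (Equiv.refl A)) (homOfEquiv (assocEquiv B C D)) =
      homOfEquiv (assocEquiv (sumObj A B) C D) ≫ homOfEquiv (assocEquiv A B (sumObj C D))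
    simp only [sumHom_homOfEquiv, homOfEquiv_trans]
    refine homOfEquiv_congr ?_
    rintro (((a | a) | a) | a) <;> rfl)
  (triangle := fun A B => by
    change homOfEquiv (assocEquiv A emptyObj B) ≫
        sumHom (homOfEquiv (Equiv.refl A)) (homOfEquiv (leftEquiv B)) =
      sumHom (homOfEquiv (rightEquiv A)) (homOfEquiv (Equiv.refl B))
    simp only [sumHom_homOfEquiv, homOfEquiv_trans]
    refine homOfEquiv_congr ?_
    rintro ((a | a) | a)
    · rfl
    · exact PEmpty.elim a
    · rfl)

/-- The braiding exchanges the two summands. -/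
instance instBraided : BraidedCategory Obj.{u} where
  braiding A B := isoOfEquiv (commEquiv A B)
  braiding_naturality_right X {Y Z} f := hom_ext fun i j => by
    refine (comp_homOfEquiv_hat _ (commEquiv X Z) i j).trans
      (Eq.trans ?_ (homOfEquiv_comp_hat (commEquiv X Y) _ i j).symm)
    rcases i with i | i <;> rcases j with j | j <;> rfl
  braiding_naturality_left {X Y} f Z := hom_ext fun i j => by
    refine (comp_homOfEquiv_hat _ (commEquiv Y Z) i j).trans
      (Eq.trans ?_ (homOfEquiv_comp_hat (commEquiv X Z) _ i j).symm)
    rcases i with i | i <;> rcases j with j | j <;> rfl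
  hexagon_forward X Y Z := by
    change homOfEquiv (assocEquiv X Y Z) ≫ homOfEquiv (commEquiv X (sumObj Y Z)) ≫
        homOfEquiv (assocEquiv Y Z X) =
      sumHom (homOfEquiv (commEquiv X Y)) (homOfEquiv (Equiv.refl Z)) ≫
        homOfEquiv (assocEquiv Y X Z) ≫
        sumHom (homOfEquiv (Equiv.refl Y)) (homOfEquiv (commEquiv X Z))
    simp only [sumHom_homOfEquiv, homOfEquiv_trans]
    refine homOfEquiv_congr ?_
    rintro ((a | a) | a) <;> rfl
  hexagon_reverse X Y Z := by
    change homOfEquiv (assocEquiv X Y Z).symm ≫ homOfEquiv (commEquiv (sumObj X Y) Z) ≫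
        homOfEquiv (assocEquiv Z X Y).symm =
      sumHom (homOfEquiv (Equiv.refl X)) (homOfEquiv (commEquiv Y Z)) ≫
        homOfEquiv (assocEquiv X Z Y).symm ≫
        sumHom (homOfEquiv (commEquiv X Z)) (homOfEquiv (Equiv.refl Y))
    simp only [sumHom_homOfEquiv, homOfEquiv_trans]
    refine homOfEquiv_congr ?_
    rintro (a | a | a) <;> rfl

instance instSymmetric : SymmetricCategory Obj.{u} where
  symmetry A B := by
    change homOfEquiv (commEquiv A B) ≫ homOfEquiv (commEquiv B A) =
      homOfEquiv (Equiv.refl (sumObj A B))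
    rw [homOfEquiv_trans]
    refine homOfEquiv_congr ?_
    rintro (a | a) <;> rfl

section Execution

variable {A B U : Obj.{u}}

/-- The zero morphism. -/
def zero (A B : Obj.{u}) : A ⟶ B := zeroHom A B

/-- The quasi-projection `π_A : A ⊕ U → A`. -/
def fst (A U : Obj.{u}) : A ⊗ U ⟶ A := (𝟙 A ⊗ₘ zero U (𝟙_ Obj)) ≫ (ρ_ A).hom

/-- The quasi-injection `ι_A : A → A ⊕ U`. -/
def inl (A U : Obj.{u}) : A ⟶ A ⊗ U := (ρ_ A).inv ≫ (𝟙 A ⊗ₘ zero (𝟙_ Obj) U)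

/-- The quasi-projection `π_U : A ⊕ U → U`. -/
def snd (A U : Obj.{u}) : A ⊗ U ⟶ U := (zero A (𝟙_ Obj) ⊗ₘ 𝟙 U) ≫ (λ_ U).hom

/-- The quasi-injection `ι_U : U → A ⊕ U`. -/
def inr (A U : Obj.{u}) : U ⟶ A ⊗ U := (λ_ U).inv ≫ (zero (𝟙_ Obj) A ⊗ₘ 𝟙 U)

/-- The component `f_BA` of `f : A ⊕ U → B ⊕ U`. -/
def compBA (f : A ⊗ U ⟶ B ⊗ U) : A ⟶ B := inl A U ≫ f ≫ fst B U

/-- The component `f_BU` of `f : A ⊕ U → B ⊕ U`. -/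
def compBU (f : A ⊗ U ⟶ B ⊗ U) : U ⟶ B := inr A U ≫ f ≫ fst B U

/-- The component `f_UA` of `f : A ⊕ U → B ⊕ U`. -/
def compUA (f : A ⊗ U ⟶ B ⊗ U) : A ⟶ U := inl A U ≫ f ≫ snd B U

/-- The component `f_UU` of `f : A ⊕ U → B ⊕ U`. -/
def compUU (f : A ⊗ U ⟶ B ⊗ U) : U ⟶ U := inr A U ≫ f ≫ snd B U

/-- Iterated composition of an endomorphism. -/
def iter (h : U ⟶ U) : ℕ → (U ⟶ U)
  | 0 => 𝟙 U
  | n + 1 => iter h n ≫ h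

/-- The family `{f_BA} ⊎ {f_BU f_UU^n f_UA}_{n ∈ ℕ}`. -/
def paths (f : A ⊗ U ⟶ B ⊗ U) : Unit ⊕ ℕ → (A ⟶ B) :=
  Sum.elim (fun _ => compBA f) fun n => compUA f ≫ iter (compUU f) n ≫ compBU f

/-- `Σ f = g` in `LSI_≤`: at each frequency, the net of finite partial sums of the countable
family `{(f̂_i)_ω}` converges to `ĝ_ω`. -/
def IsSum {ι : Type v} [Countable ι] (f : ι → (A ⟶ B)) (g : A ⟶ B) : Prop :=
  ∀ᵐ ω : ℝ, HasSum (fun i => evalAt (f i).hat ω) (evalAt g.hat ω)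

end Execution

/-- The axioms of a (total) trace on a symmetric monoidal category. -/
structure IsTrace {C : Type u} [Category.{v} C] [MonoidalCategory C] [SymmetricCategory C]
    (tr : ∀ A B U : C, (A ⊗ U ⟶ B ⊗ U) → (A ⟶ B)) : Prop where
  naturality : ∀ {A A' B B' U : C} (g : A' ⟶ A) (f : A ⊗ U ⟶ B ⊗ U) (h : B ⟶ B'),
    g ≫ tr A B U f ≫ h = tr A' B' U ((g ▷ U) ≫ f ≫ (h ▷ U))
  dinaturality : ∀ {A B U U' : C} (f : A ⊗ U ⟶ B ⊗ U') (g : U' ⟶ U),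
    tr A B U (f ≫ (B ◁ g)) = tr A B U' ((A ◁ g) ≫ f)
  superposing : ∀ {A B D E U : C} (g : D ⟶ E) (f : A ⊗ U ⟶ B ⊗ U),
    g ⊗ₘ tr A B U f = tr (D ⊗ A) (E ⊗ B) U ((α_ D A U).hom ≫ (g ⊗ₘ f) ≫ (α_ E B U).inv)
  vanishing_unit : ∀ {A B : C} (f : A ⊗ 𝟙_ C ⟶ B ⊗ 𝟙_ C),
    tr A B (𝟙_ C) f = (ρ_ A).inv ≫ f ≫ (ρ_ B).hom
  vanishing_tensor : ∀ {A B U V : C} (f : (A ⊗ U) ⊗ V ⟶ (B ⊗ U) ⊗ V),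
    tr A B U (tr (A ⊗ U) (B ⊗ U) V f) =
      tr A B (U ⊗ V) ((α_ A U V).inv ≫ f ≫ (α_ B U V).hom)
  yanking : ∀ U : C, tr U U U (β_ U U).hom = 𝟙 U

end LSI

end

/-! At almost every frequency `f` is a contraction between finite-dimensional spaces with blocks `a,
b, c, d`, so nearly everything can be argued one frequency at a time. Contractivity is an energy
balance: what leaves the loop through `b` is lost to `d`, so `∑ ‖b dⁿ v‖² ≤ ‖v‖²`. The same holds
for the adjoint row `(c*, d*)`, so `‖dⁿ c‖` is square-summable too. Splitting each path in its
middle, `b dᵐ⁺ⁿ c = (b dᵐ)(dⁿ c)`, gives absolute convergence (`summable_feedback`).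

Although `1 - d` need not be invertible, the loop equation `c x + d u = u` always has a solution,
because `c*` kills the kernel of `1 - d*`; for any solution the path series telescopes to `b u`
(`exists_feedback`). The solution `u` may fail to be unique, but the output is unique by the energy
balance (`eq_of_act_eq_pair`). So summing the paths is the same as solving the loop equation
(`isSum_paths_iff`), and each trace axiom reduces to exhibiting a loop vector.

For the sum to be a morphism, its entries must be transforms of shift-invariant operators. They are
almost everywhere limits of such transforms and are bounded by 1, hence come from bounded measurable
functions on the circle, which act by multiplication (`IsEntry.exists_of_tendsto`). The contraction
in the time domain is then Plancherel's theorem (`IsLSI.norm_apply_le`). -/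

namespace LSI

open scoped ComplexInnerProductSpace

/-! ### Dissipative loops at a single frequency -/

section Feedback

variable {X Y U : Type*} [NormedAddCommGroup X] [InnerProductSpace ℂ X]
  [NormedAddCommGroup Y] [InnerProductSpace ℂ Y] [NormedAddCommGroup U] [InnerProductSpace ℂ U]

/-- The energy that leaves a dissipative loop is bounded by the initial energy. -/
lemma summable_sq_iterate {b : U →L[ℂ] Y} {d : U →L[ℂ] U}
    (h : ∀ u, ‖b u‖ ^ 2 + ‖d u‖ ^ 2 ≤ ‖u‖ ^ 2) (v : U) :
    Summable fun n => ‖(b ∘L d ^ n) v‖ ^ 2 := by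
  refine summable_of_sum_range_le (c := ‖v‖ ^ 2) (fun n => by positivity) fun n => ?_
  -- The energy still in the loop after `n` rounds is kept in the bound so that the induction
  -- closes.
  have : ∑ i ∈ Finset.range n, ‖(b ∘L d ^ i) v‖ ^ 2 + ‖(d ^ n) v‖ ^ 2 ≤ ‖v‖ ^ 2 := by
    induction n with
    | zero => simp
    | succ n ih =>
      rw [Finset.sum_range_succ]
      have := h ((d ^ n) v)
      rw [pow_succ' d n]
      simp only [mul_apply_eq_comp, ContinuousLinearMap.comp_apply] at *
      linarith
  nlinarith [sq_nonneg ‖(d ^ n) v‖]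

variable [FiniteDimensional ℂ U]

/-- Pointwise square-summable families of operators on a finite-dimensional space are
square-summable in operator norm. -/
lemma summable_sq_opNorm {T : ℕ → U →L[ℂ] Y} (h : ∀ v, Summable fun n => ‖T n v‖ ^ 2) :
    Summable fun n => ‖T n‖ ^ 2 := by
  let e := stdOrthonormalBasis ℂ U
  have hs : Summable fun n => ((Finset.univ : Finset (Fin (Module.finrank ℂ U))).card : ℝ) *
      ∑ i, ‖T n (e i)‖ ^ 2 :=
    (summable_sum fun i _ => h (e i)).mul_left _
  refine hs.of_nonneg_of_le (fun n => by positivity) fun n => ?_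
  have h1 : ‖T n‖ ≤ ∑ i, ‖T n (e i)‖ := by
    refine ContinuousLinearMap.opNorm_le_bound _ (by positivity) fun v => ?_
    calc ‖T n v‖ = ‖∑ i, ⟪e i, v⟫ • T n (e i)‖ := by
          conv_lhs => rw [← e.sum_repr' v]
          simp
      _ ≤ ∑ i, ‖⟪e i, v⟫ • T n (e i)‖ := norm_sum_le _ _
      _ ≤ ∑ i, ‖T n (e i)‖ * ‖v‖ := by
          refine Finset.sum_le_sum fun i _ => ?_
          rw [norm_smul, mul_comm]
          gcongr
          simpa using norm_inner_le_norm (𝕜 := ℂ) (e i) v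
      _ = _ := by rw [Finset.sum_mul]
  exact (pow_le_pow_left₀ (norm_nonneg _) h1 2).trans sq_sum_le_card_mul_sum_sq

variable [FiniteDimensional ℂ X]

/-- The second row of a contraction in block form has a contractive adjoint. -/
lemma adjoint_row_le {c : X →L[ℂ] U} {d : U →L[ℂ] U}
    (h : ∀ x u, ‖c x + d u‖ ^ 2 ≤ ‖x‖ ^ 2 + ‖u‖ ^ 2) (v : U) :
    ‖c.adjoint v‖ ^ 2 + ‖d.adjoint v‖ ^ 2 ≤ ‖v‖ ^ 2 := by
  set s := ‖c.adjoint v‖ ^ 2 + ‖d.adjoint v‖ ^ 2 with hs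
  have h0 : 0 ≤ s := by positivity
  -- Cauchy–Schwarz on this identity, with the contraction applied to `(c* v, d* v)`, gives `s² ≤
  -- ‖v‖² s`, hence `s ≤ ‖v‖²`.
  have h1 : s = RCLike.re ⟪v, c (c.adjoint v) + d (d.adjoint v)⟫ := by
    rw [inner_add_right, ← ContinuousLinearMap.adjoint_inner_left c,
      ← ContinuousLinearMap.adjoint_inner_left d, map_add, inner_self_eq_norm_sq,
      inner_self_eq_norm_sq]
  have h2 : s ≤ ‖v‖ * ‖c (c.adjoint v) + d (d.adjoint v)‖ :=
    h1.le.trans (re_inner_le_norm _ _)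
  have h3 := h (c.adjoint v) (d.adjoint v)
  have h4 : s ^ 2 ≤ ‖v‖ ^ 2 * s := by
    calc s ^ 2 ≤ (‖v‖ * ‖c (c.adjoint v) + d (d.adjoint v)‖) ^ 2 := pow_le_pow_left₀ h0 h2 2
      _ = ‖v‖ ^ 2 * ‖c (c.adjoint v) + d (d.adjoint v)‖ ^ 2 := by ring
      _ ≤ _ := by gcongr
  by_contra! hlt
  have : 0 < s := (sq_nonneg _).trans_lt hlt
  nlinarith

variable [CompleteSpace Y]

/-- The family `b dⁿ c` of paths through a dissipative loop is absolutely summable. -/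
lemma summable_feedback {b : U →L[ℂ] Y} {c : X →L[ℂ] U} {d : U →L[ℂ] U}
    (hb : ∀ u, ‖b u‖ ^ 2 + ‖d u‖ ^ 2 ≤ ‖u‖ ^ 2)
    (hc : ∀ v, ‖c.adjoint v‖ ^ 2 + ‖d.adjoint v‖ ^ 2 ≤ ‖v‖ ^ 2) :
    Summable fun n => b ∘L (d ^ n) ∘L c := by
  have h1 : Summable fun n => ‖b ∘L d ^ n‖ ^ 2 := summable_sq_opNorm (summable_sq_iterate hb)
  -- The adjoint of `dⁿ c` is `c* (d*)ⁿ`, a path leaving the adjoint loop, and it has the same norm.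
  have h2 : Summable fun n => ‖(d ^ n) ∘L c‖ ^ 2 := by
    have := summable_sq_opNorm (summable_sq_iterate hc)
    refine this.congr fun n => ?_
    rw [← LinearIsometryEquiv.norm_map ContinuousLinearMap.adjoint ((d ^ n) ∘L c),
      ContinuousLinearMap.adjoint_comp]
    simp only [← ContinuousLinearMap.star_eq_adjoint, star_pow]
  -- A product is dominated by a sum of squares. The exponents `2n = n + n` and `2n + 1 = (n + 1) +
  -- n` call for `p = id` and `p = succ`.
  have key : ∀ p : ℕ → ℕ, p.Injective →
      Summable fun n => ‖b ∘L d ^ (p n)‖ * ‖(d ^ n) ∘L c‖ := by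
    intro p hp
    refine ((h1.comp_injective hp).add h2).of_nonneg_of_le (fun n => by positivity) fun n => ?_
    simp only [Function.comp_apply]
    nlinarith [sq_nonneg (‖b ∘L d ^ (p n)‖ - ‖(d ^ n) ∘L c‖), sq_nonneg ‖b ∘L d ^ (p n)‖,
      sq_nonneg ‖(d ^ n) ∘L c‖]
  have split : ∀ m n : ℕ, b ∘L (d ^ (m + n)) ∘L c = (b ∘L d ^ m) ∘L ((d ^ n) ∘L c) := by
    intro m n; rw [pow_add]; rfl
  have bound : ∀ m n : ℕ, ‖b ∘L (d ^ (m + n)) ∘L c‖ ≤ ‖b ∘L d ^ m‖ * ‖(d ^ n) ∘L c‖ := by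
    intro m n
    rw [split]; exact ContinuousLinearMap.opNorm_comp_le _ _
  refine Summable.of_norm ?_
  refine Summable.even_add_odd (f := fun n => ‖b ∘L (d ^ n) ∘L c‖) ?_ ?_
  · refine (key id Function.injective_id).of_nonneg_of_le (fun n => by positivity) fun n => ?_
    rw [two_mul]; exact bound n n
  · refine (key Nat.succ Nat.succ_injective).of_nonneg_of_le (fun n => by positivity) fun n => ?_
    rw [show 2 * n + 1 = n.succ + n by omega]; exact bound _ n

/-- The sum over all paths through the loop of a contraction in block form is computed by a
solution of the feedback equation. -/
lemma exists_feedback {a : X →L[ℂ] Y} {b : U →L[ℂ] Y} {c : X →L[ℂ] U} {d : U →L[ℂ] U}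
    (h : ∀ x u, ‖a x + b u‖ ^ 2 + ‖c x + d u‖ ^ 2 ≤ ‖x‖ ^ 2 + ‖u‖ ^ 2) (x : X) :
    ∃ u, c x + d u = u ∧ HasSum (fun n => b ((d ^ n) (c x))) (b u) := by
  have hb : ∀ u, ‖b u‖ ^ 2 + ‖d u‖ ^ 2 ≤ ‖u‖ ^ 2 := fun u => by simpa using h 0 u
  have hc := adjoint_row_le (c := c) (d := d) fun x u =>
    (le_add_of_nonneg_left (sq_nonneg _)).trans (h x u)
  -- In finite dimension a range is its own double orthogonal complement. A vector orthogonal to the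
  -- range of `1 - d` is fixed by `d*`, so the adjoint energy balance leaves nothing for `c*`, and
  -- the vector is orthogonal to `c x`.
  have hmem : c x ∈ (LinearMap.range (1 - d : U →L[ℂ] U).toLinearMap) := by
    rw [← Submodule.orthogonal_orthogonal (LinearMap.range (1 - d : U →L[ℂ] U).toLinearMap)]
    intro v hv
    have hd : d.adjoint v = v := by
      have h1 : ∀ w, ⟪v - d.adjoint v, w⟫ = 0 := by
        intro w
        rw [inner_sub_left, ContinuousLinearMap.adjoint_inner_left, ← inner_sub_right]
        exact inner_eq_zero_symm.1 (hv _ ⟨w, rfl⟩)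
      exact (sub_eq_zero.1 (inner_self_eq_zero.1 (h1 _))).symm
    have h2 := hc v
    rw [hd] at h2
    have h3 : c.adjoint v = 0 := by
      rw [← norm_eq_zero]
      exact pow_eq_zero_iff two_ne_zero |>.1 (le_antisymm (by linarith) (sq_nonneg _))
    rw [← ContinuousLinearMap.adjoint_inner_left c, h3, inner_zero_left]
  obtain ⟨u, hu⟩ := hmem
  have hu' : c x = u - d u := hu.symm
  refine ⟨u, by rw [hu']; abel, ?_⟩
  have hs : Summable fun n => b ((d ^ n) (c x)) :=
    (summable_feedback hb hc).mapL (ContinuousLinearMap.apply ℂ Y x)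
  rw [hs.hasSum_iff_tendsto_nat]
  -- Substituting `c x = u - d u` makes the series telescope. The remainder `b dⁿ u` vanishes
  -- because its squared norms are summable, even when `dⁿ u` itself does not tend to zero.
  have hsum : ∀ n, ∑ i ∈ Finset.range n, b ((d ^ i) (c x)) = b u - b ((d ^ n) u) := by
    intro n
    induction n with
    | zero => simp
    | succ n ih =>
      rw [Finset.sum_range_succ, ih, hu', pow_succ]
      simp
  simp only [hsum]
  have h0 : Filter.Tendsto (fun n => b ((d ^ n) u)) Filter.atTop (nhds 0) := by
    have h1 := (summable_sq_iterate hb u).tendsto_atTop_zero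
    rw [tendsto_zero_iff_norm_tendsto_zero]
    have := h1.sqrt
    simpa [Real.sqrt_sq] using this
  simpa using tendsto_const_nhds.sub h0

end Feedback

/-- The matrix form of `exists_feedback`. -/
lemma IsContraction.exists_feedback {A B U : Type u} [Fintype A] [DecidableEq A] [Fintype B]
    [DecidableEq B] [Fintype U] [DecidableEq U] {a : Matrix B A ℂ} {b : Matrix B U ℂ}
    {c : Matrix U A ℂ} {d : Matrix U U ℂ} (h : IsContraction (Matrix.fromBlocks a b c d))
    (x : A → ℂ) :
    ∃ u, c.mulVec x + d.mulVec u = u ∧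
      HasSum (fun n => b.mulVec ((d ^ n).mulVec (c.mulVec x))) (b.mulVec u) := by
  rw [isContraction_iff] at h
  let L {I J : Type u} [Fintype I] [DecidableEq I] [Fintype J] (M : Matrix J I ℂ) :
    EuclideanSpace ℂ I →L[ℂ] EuclideanSpace ℂ J := (Matrix.toEuclideanLin M).toContinuousLinearMap
  have hL : ∀ {I J : Type u} [Fintype I] [DecidableEq I] [Fintype J] (M : Matrix J I ℂ)
    (v : EuclideanSpace ℂ I), L M v = WithLp.toLp 2 (M.mulVec v.ofLp) := fun M v => rfl
  obtain ⟨u, hu, hs⟩ := LSI.exists_feedback (a := L a) (b := L b) (c := L c) (d := L d)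
    (fun x u => by
      have := h (Sum.elim x.ofLp u.ofLp)
      rw [Matrix.fromBlocks_mulVec, Fintype.sum_sum_type, Fintype.sum_sum_type] at this
      simp only [EuclideanSpace.norm_sq_eq]
      simpa [hL] using this) (WithLp.toLp 2 x)
  have hpow : ∀ (n : ℕ) v, ((L d) ^ n) v = WithLp.toLp 2 ((d ^ n).mulVec v.ofLp) := by
    intro n
    induction n with
    | zero => intro v; simp
    | succ n ih => intro v; rw [pow_succ, pow_succ, mul_apply_eq_comp, ih, hL]; simp
  refine ⟨u.ofLp, congrArg WithLp.ofLp hu, ?_⟩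
  have := hs.mapL (PiLp.continuousLinearEquiv 2 ℂ (fun _ : B => ℂ)).toContinuousLinearMap
  simp only [hL, hpow] at this
  exact this

/-! ### Which functions are symbols of shift-invariant operators -/

lemma dtftCircle_shift_ae (τ : ℤ) (f : EllTwo) :
    dtftCircle (shift τ f) =ᵐ[AddCircle.haarAddCircle]
      fun x => fourier (-τ) x * dtftCircle f x := by
  filter_upwards [mulL1_ae (fourierLp 2 0) (dtftCircle (shift τ f)),
    mulL1_ae (fourierLp 2 (-τ)) (dtftCircle f), coeFn_fourierLp (T := 2 * π) 2 0,
    coeFn_fourierLp (T := 2 * π) 2 (-τ)] with x h1 h2 h3 h4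
  rw [mulL1_shift, h2, h3, h4] at h1
  simpa using h1.symm

/-- Bounded measurable functions on a period are transforms of bounded shift invariant maps. -/
lemma IsEntry.of_bounded {m : Freq} (G : AddCircle (2 * π) → ℂ) (hG : StronglyMeasurable G)
    (C : ℝ) (hC : ∀ x, ‖G x‖ ≤ C) (hm : m =ᵐ[volume] fun ω : ℝ => G ω) : IsEntry m := by
  have hmem : MemLp G ⊤ (AddCircle.haarAddCircle (T := 2 * π)) :=
    memLp_top_of_bound hG.aestronglyMeasurable C (.of_forall hC)
  let T : Lp ℂ 2 (AddCircle.haarAddCircle (T := 2 * π)) →L[ℂ]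
      Lp ℂ 2 (AddCircle.haarAddCircle (T := 2 * π)) :=
    (ContinuousLinearMap.mul ℂ ℂ).holderL AddCircle.haarAddCircle ⊤ 2 2 (hmem.toLp G)
  have hT : ∀ f, T f =ᵐ[AddCircle.haarAddCircle] fun x => G x * f x := by
    intro f
    have := (ContinuousLinearMap.mul ℂ ℂ).coeFn_holder (r := 2) (hmem.toLp G) f
    filter_upwards [this, hmem.coeFn_toLp] with x h1 h2
    rw [← h2]; exact h1
  -- Multiplication by `G` conjugated by the Fourier transform; shifts become multiplication by
  -- characters, which commutes with it.
  let K : EllTwo →L[ℂ] EllTwo :=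
    (dtftCircle.symm.toContinuousLinearEquiv : _ →L[ℂ] EllTwo) ∘L T ∘L
      (dtftCircle.toContinuousLinearEquiv : EllTwo →L[ℂ] _)
  have hK : ∀ f, dtftCircle (K f) = T (dtftCircle f) := fun f =>
    dtftCircle.apply_symm_apply _
  refine ⟨K, fun τ ψ => ?_, ?_⟩
  · apply dtftCircle.injective
    rw [hK]
    refine Lp.ext ?_
    filter_upwards [hT (dtftCircle (shift τ ψ)), dtftCircle_shift_ae τ ψ,
      dtftCircle_shift_ae τ (K ψ), hT (dtftCircle ψ)] with x h1 h2 h3 h4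
    rw [h1, h2, h3, hK, h4]; ring
  · refine dtft_eq_of_circle hm G (fun _ => rfl) ?_
    have h0 : dtftCircle delta = fourierLp 2 0 := dtftCircle_single 0
    rw [hK, h0]
    filter_upwards [hT (fourierLp 2 0), coeFn_fourierLp (T := 2 * π) 2 0] with x h1 h2
    rw [h1, h2]; simp

/-- Bounded pointwise limits of transforms of shift invariant maps are such transforms. -/
lemma IsEntry.exists_of_tendsto {m : ℕ → Freq} (hm : ∀ n, IsEntry (m n)) {F : ℝ → ℂ}
    (hF : ∀ᵐ ω : ℝ, Filter.Tendsto (fun n => m n ω) Filter.atTop (nhds (F ω)))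
    {C : ℝ} (hC : ∀ᵐ ω : ℝ, ‖F ω‖ ≤ C) : ∃ g : Freq, IsEntry g ∧ g =ᵐ[volume] F := by
  choose K _ hKm using hm
  have hC0 : 0 ≤ C := by
    obtain ⟨ω, h⟩ := hC.exists
    exact (norm_nonneg _).trans h
  -- `F` is not assumed periodic or measurable, so the limit is retaken on the circle. The default
  -- value of `limUnder` where there is no limit is harmless: pulled back to `ℝ`, such points form a
  -- null set.
  let G₀ : AddCircle (2 * π) → ℂ := fun x =>
    Filter.limUnder Filter.atTop fun n => dtftCircle (K n delta) x
  have hG₀ : StronglyMeasurable G₀ :=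
    StronglyMeasurable.limUnder fun n => Lp.stronglyMeasurable (dtftCircle (K n delta))
  let s : Set (AddCircle (2 * π)) := {x | ‖G₀ x‖ ≤ C}
  have hs : MeasurableSet s := measurableSet_le hG₀.norm.measurable measurable_const
  -- Truncation makes the bound hold everywhere, without changing the almost everywhere class of the
  -- pullback to `ℝ`.
  let G := s.indicator G₀
  have hG : StronglyMeasurable G := hG₀.indicator hs
  have hGC : ∀ x, ‖G x‖ ≤ C := by
    intro x
    by_cases h : x ∈ s
    · rw [show G x = G₀ x from Set.indicator_of_mem h _]; exact h
    · simpa only [G, Set.indicator_of_notMem h, norm_zero] using hC0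
  have hGF : (fun ω : ℝ => G ω) =ᵐ[volume] F := by
    filter_upwards [hF, hC, ae_all_iff.2 fun n => dtft_ae (K n delta)] with ω h1 h2 h3
    have h4 : G₀ ω = F ω := by
      refine Filter.Tendsto.limUnder_eq (h1.congr fun n => ?_)
      rw [← h3 n, hKm]
    have h5 : (ω : AddCircle (2 * π)) ∈ s := by
      change ‖G₀ ω‖ ≤ C
      rwa [h4]
    simp only [G, Set.indicator_of_mem h5, h4]
  have hmeas : AEStronglyMeasurable (fun ω : ℝ => G ω) volume :=
    (hG.comp_measurable AddCircle.measurable_mk').aestronglyMeasurable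
  refine ⟨AEEqFun.mk _ hmeas, IsEntry.of_bounded G hG C hGC (AEEqFun.coeFn_mk _ hmeas),
    (AEEqFun.coeFn_mk _ hmeas).trans hGF⟩

/-! ### Plancherel and contractions in the time domain -/

lemma lintegral_dtft (f : EllTwo) :
    ∫⁻ ω in Set.Ioc 0 (2 * π), ‖dtft f ω‖ₑ ^ 2 = ENNReal.ofReal (2 * π) * ‖f‖ₑ ^ 2 := by
  have h1 : ∫⁻ ω in Set.Ioc 0 (2 * π), ‖dtft f ω‖ₑ ^ 2 =
      ∫⁻ ω in Set.Ioc 0 (0 + 2 * π), ‖dtftCircle f (ω : AddCircle (2 * π))‖ₑ ^ 2 := by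
    rw [zero_add]
    refine lintegral_congr_ae (ae_restrict_of_ae ?_)
    filter_upwards [dtft_ae f] with ω h
    rw [h]
  -- The factor `2π` is the mass of a period relative to the normalised Haar measure for which the
  -- transform is isometric.
  rw [h1, AddCircle.lintegral_preimage (2 * π) 0 fun x => ‖dtftCircle f x‖ₑ ^ 2,
    AddCircle.volume_eq_smul_haarAddCircle, lintegral_smul_measure, smul_eq_mul,
    ← dtftCircle.enorm_map f, Lp.enorm_def,
    eLpNorm_eq_lintegral_rpow_enorm_toReal (by norm_num) (by norm_num)]
  congr 1
  simp only [ENNReal.toReal_ofNat, ENNReal.rpow_ofNat]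
  rw [← ENNReal.rpow_natCast, ← ENNReal.rpow_mul]
  norm_num

lemma enorm_sq_sumEllTwo {A : Type u} [Fintype A] (Ψ : SumEllTwo A) :
    ‖Ψ‖ₑ ^ 2 = ∑ a, ‖Ψ a‖ₑ ^ 2 := by
  have h := PiLp.norm_sq_eq_of_L2 (fun _ : A => EllTwo) Ψ
  simp only [← ofReal_norm, ← ENNReal.ofReal_pow (norm_nonneg _)]
  rw [h, ENNReal.ofReal_sum_of_nonneg fun _ _ => by positivity]

lemma dtft_sum {A : Type u} (s : Finset A) (f : A → EllTwo) :
    dtft (∑ a ∈ s, f a) = ∑ a ∈ s, dtft (f a) := by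
  classical
  induction s using Finset.induction_on with
  | empty => simpa using dtft_zero
  | insert a s ha ih => rw [Finset.sum_insert ha, Finset.sum_insert ha, dtft_add, ih]

lemma apply_eq_sum_component {A B : Type u} [Fintype A] [DecidableEq A] [Fintype B]
    (D : SumEllTwo A →L[ℂ] SumEllTwo B) (Ψ : SumEllTwo A) (b : B) :
    D Ψ b = ∑ a, component D b a (Ψ a) := by
  have h : Ψ = ∑ a, inj a (Ψ a) := by
    ext1 a
    have : ∀ a', (inj a' (Ψ a') : SumEllTwo A) a = if a = a' then Ψ a' else 0 :=
      fun a' => Pi.single_apply a' (Ψ a') a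
    rw [WithLp.ofLp_sum, Finset.sum_apply]
    simp [this]
  conv_lhs => rw [h, map_sum, WithLp.ofLp_sum, Finset.sum_apply]
  rfl

/-- At almost every frequency, a linear shift invariant map acts by its representing matrix. -/
lemma IsLSI.dtft_apply_ae {A B : Type u} [Fintype A] [DecidableEq A] [Fintype B] [DecidableEq B]
    {D : SumEllTwo A →L[ℂ] SumEllTwo B} (hD : IsLSI D) (Ψ : SumEllTwo A) :
    ∀ᵐ ω : ℝ, ∀ b, dtft (D Ψ b) ω = (evalAt (hatOf D) ω).mulVec (fun a => dtft (Ψ a) ω) b := by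
  -- The vector of transforms is viewed as a one-column matrix, so that the pointwise product rule
  -- for matrices applies.
  filter_upwards [evalAt_mul (hatOf D) (Matrix.of fun (a : A) (_ : PUnit.{u + 1}) => dtft (Ψ a))]
    with ω h b
  have h1 : dtft (D Ψ b) = (hatOf D * Matrix.of fun (a : A) (_ : PUnit.{u + 1}) => dtft (Ψ a)) b
      PUnit.unit := by
    rw [apply_eq_sum_component, dtft_sum, Matrix.mul_apply]
    exact Finset.sum_congr rfl fun a _ => dtft_apply _ (hD b a) _
  rw [h1]
  exact congr_fun (congr_fun h b) PUnit.unit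

/-- A linear shift invariant map represented by contractions is a contraction. -/
lemma IsLSI.norm_apply_le {A B : Type u} [Fintype A] [DecidableEq A] [Fintype B] [DecidableEq B]
    {D : SumEllTwo A →L[ℂ] SumEllTwo B} (hD : IsLSI D)
    (h : ∀ᵐ ω : ℝ, IsContraction (evalAt (hatOf D) ω)) (Ψ : SumEllTwo A) : ‖D Ψ‖ ≤ ‖Ψ‖ := by
  have hint : ∀ {I : Type u} [Fintype I] (Φ : SumEllTwo I),
      ENNReal.ofReal (2 * π) * ‖Φ‖ₑ ^ 2 =
        ∫⁻ ω in Set.Ioc 0 (2 * π), ∑ i, ‖dtft (Φ i) ω‖ₑ ^ 2 := by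
    intro I _ Φ
    rw [lintegral_finsetSum' _ fun i _ => ((AEEqFun.aestronglyMeasurable _).enorm.pow_const
      2).restrict, enorm_sq_sumEllTwo, Finset.mul_sum]
    simp only [lintegral_dtft]
  have hle : ENNReal.ofReal (2 * π) * ‖D Ψ‖ₑ ^ 2 ≤ ENNReal.ofReal (2 * π) * ‖Ψ‖ₑ ^ 2 := by
    rw [hint, hint]
    refine lintegral_mono_ae (ae_restrict_of_ae ?_)
    filter_upwards [h, hD.dtft_apply_ae Ψ] with ω h1 h2
    have h3 := (isContraction_iff _).1 h1 fun a => dtft (Ψ a) ω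
    simp only [h2, ← ofReal_norm, ← ENNReal.ofReal_pow (norm_nonneg _)]
    rw [← ENNReal.ofReal_sum_of_nonneg fun _ _ => by positivity,
      ← ENNReal.ofReal_sum_of_nonneg fun _ _ => by positivity]
    exact ENNReal.ofReal_le_ofReal h3
  have hle' := (ENNReal.mul_le_mul_iff_right (by simpa using Real.pi_pos) ENNReal.ofReal_ne_top).1 hle
  have := (ENNReal.pow_le_pow_left_iff two_ne_zero).1 hle'
  exact enorm_le_iff_norm_le.1 this

/-! ### Morphisms as linear maps at almost every frequency -/

/-- The action `ℂ^A → ℂ^B` of a morphism at the frequency `ω`. -/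
noncomputable def act {A B : Obj.{u}} (f : A ⟶ B) (ω : ℝ) (x : A → ℂ) : B → ℂ :=
  (evalAt f.hat ω).mulVec x

/-- The vector of `ℂ^A ⊕ ℂ^B` with the given components. -/
def pair {A B : Obj.{u}} (x : A → ℂ) (y : B → ℂ) : (A ⊗ B : Obj.{u}) → ℂ :=
  fun i => Sum.elim x y i

section Pair

variable {A B : Obj.{u}}

lemma pair_inj {x x' : A → ℂ} {y y' : B → ℂ} (h : pair x y = pair x' y') : x = x' ∧ y = y' :=
  ⟨funext fun a => congr_fun h (Sum.inl a), funext fun b => congr_fun h (Sum.inr b)⟩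

lemma exists_pair (z : (A ⊗ B : Obj.{u}) → ℂ) : ∃ x y, z = pair x y :=
  ⟨fun a => z (Sum.inl a), fun b => z (Sum.inr b), by
    funext i
    exact Sum.rec (motive := fun i => z i = pair (A := A) (B := B) (fun a => z (Sum.inl a))
      (fun b => z (Sum.inr b)) i) (fun _ => rfl) (fun _ => rfl) i⟩

lemma sum_pair (x : A → ℂ) (y : B → ℂ) :
    ∑ i, ‖pair x y i‖ ^ 2 = ∑ a, ‖x a‖ ^ 2 + ∑ b, ‖y b‖ ^ 2 :=
  Fintype.sum_sum_type (α₁ := A) (α₂ := B) fun i => ‖Sum.elim x y i‖ ^ 2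

end Pair

section Act

variable {A B C D : Obj.{u}}

/-- The exceptional null set does not depend on `x`. This uniformity, shared by the lemmas below,
allows vectors that are chosen frequency by frequency, with no measurability. -/
lemma act_comp (f : A ⟶ B) (g : B ⟶ C) :
    ∀ᵐ ω : ℝ, ∀ x, act (f ≫ g) ω x = act g ω (act f ω x) := by
  filter_upwards [evalAt_mul g.hat f.hat] with ω h x
  rw [act, act, act, Matrix.mulVec_mulVec, ← h]; rfl

lemma act_homOfEquiv (e : A ≃ B) :
    ∀ᵐ ω : ℝ, ∀ x b, act (homOfEquiv e) ω x b = x (e.symm b) := by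
  filter_upwards [evalAt_perm e] with ω h x b
  change (evalAt (permMatrix Freq e) ω).mulVec x b = _
  rw [h]
  simp [permMatrix, Matrix.mulVec, dotProduct, ← Equiv.eq_symm_apply]

lemma act_id (A : Obj.{u}) : ∀ᵐ ω : ℝ, ∀ x, act (𝟙 A) ω x = x := by
  filter_upwards [act_homOfEquiv (Equiv.refl A)] with ω h x
  exact funext (h x)

lemma act_zero (A B : Obj.{u}) : ∀ᵐ ω : ℝ, ∀ x, act (zero A B) ω x = 0 := by
  filter_upwards [evalAt_zero (A := A.carrier) (B := B.carrier)] with ω h x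
  change (evalAt (0 : Matrix B A Freq) ω).mulVec x = 0
  rw [h, Matrix.zero_mulVec]

lemma act_tensorHom (f : A ⟶ C) (g : B ⟶ D) :
    ∀ᵐ ω : ℝ, ∀ x y, act (f ⊗ₘ g) ω (pair x y) = pair (act f ω x) (act g ω y) := by
  filter_upwards [evalAt_fromBlocks f.hat g.hat] with ω h x y
  change (evalAt (Matrix.fromBlocks f.hat 0 0 g.hat) ω).mulVec (Sum.elim x y) = Sum.elim _ _
  rw [h, Matrix.fromBlocks_mulVec]
  simp [act]

lemma act_whiskerRight (f : A ⟶ C) (B : Obj.{u}) :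
    ∀ᵐ ω : ℝ, ∀ x y, act (f ▷ B) ω (pair x y) = pair (act f ω x) y := by
  filter_upwards [act_tensorHom f (𝟙 B), act_id B] with ω h h' x y
  have := h x y
  rwa [h'] at this

lemma act_whiskerLeft (A : Obj.{u}) (f : B ⟶ C) :
    ∀ᵐ ω : ℝ, ∀ x y, act (A ◁ f) ω (pair x y) = pair x (act f ω y) := by
  filter_upwards [act_tensorHom (𝟙 A) f, act_id A] with ω h h' x y
  have := h x y
  rwa [h'] at this

lemma act_associator_hom (A B C : Obj.{u}) :
    ∀ᵐ ω : ℝ, ∀ x y z, act (α_ A B C).hom ω (pair (pair x y) z) = pair x (pair y z) := by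
  filter_upwards [act_homOfEquiv (assocEquiv A B C)] with ω h x y z
  funext i
  refine (h _ i).trans ?_
  rcases i with i | i | i <;> rfl

lemma act_associator_inv (A B C : Obj.{u}) :
    ∀ᵐ ω : ℝ, ∀ x y z, act (α_ A B C).inv ω (pair x (pair y z)) = pair (pair x y) z := by
  filter_upwards [act_homOfEquiv (assocEquiv A B C).symm] with ω h x y z
  funext i
  refine (h _ i).trans ?_
  rcases i with (i | i) | i <;> rfl

lemma act_rightUnitor_hom (A : Obj.{u}) :
    ∀ᵐ ω : ℝ, ∀ x y, act (ρ_ A).hom ω (pair x y) = x := by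
  filter_upwards [act_homOfEquiv (rightEquiv A)] with ω h x y
  exact funext fun i => h _ i

lemma act_leftUnitor_hom (A : Obj.{u}) :
    ∀ᵐ ω : ℝ, ∀ x y, act (λ_ A).hom ω (pair y x) = x := by
  filter_upwards [act_homOfEquiv (leftEquiv A)] with ω h x y
  exact funext fun i => h _ i

lemma act_rightUnitor_inv (A : Obj.{u}) :
    ∀ᵐ ω : ℝ, ∀ x, act (ρ_ A).inv ω x = pair x 0 := by
  filter_upwards [act_homOfEquiv (rightEquiv A).symm] with ω h x
  funext i
  refine (h _ i).trans ?_
  rcases i with i | i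
  · rfl
  · exact PEmpty.elim i

lemma act_leftUnitor_inv (A : Obj.{u}) :
    ∀ᵐ ω : ℝ, ∀ x, act (λ_ A).inv ω x = pair 0 x := by
  filter_upwards [act_homOfEquiv (leftEquiv A).symm] with ω h x
  funext i
  refine (h _ i).trans ?_
  rcases i with i | i
  · exact PEmpty.elim i
  · rfl

lemma act_braiding_hom (A B : Obj.{u}) :
    ∀ᵐ ω : ℝ, ∀ x y, act (β_ A B).hom ω (pair x y) = pair y x := by
  filter_upwards [act_homOfEquiv (commEquiv A B)] with ω h x y
  funext i
  refine (h _ i).trans ?_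
  rcases i with i | i <;> rfl

lemma act_fst (A U : Obj.{u}) : ∀ᵐ ω : ℝ, ∀ x y, act (fst A U) ω (pair x y) = x := by
  filter_upwards [act_comp (𝟙 A ⊗ₘ zero U (𝟙_ Obj)) (ρ_ A).hom,
    act_tensorHom (𝟙 A) (zero U (𝟙_ Obj)), act_rightUnitor_hom A, act_id A] with ω h1 h2 h3 h4 x y
  rw [fst, h1, h2, h3, h4]

lemma act_snd (A U : Obj.{u}) : ∀ᵐ ω : ℝ, ∀ x y, act (snd A U) ω (pair x y) = y := by
  filter_upwards [act_comp (zero A (𝟙_ Obj) ⊗ₘ 𝟙 U) (λ_ U).hom,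
    act_tensorHom (zero A (𝟙_ Obj)) (𝟙 U), act_leftUnitor_hom U, act_id U] with ω h1 h2 h3 h4 x y
  rw [snd, h1, h2, h3, h4]

lemma act_inl (A U : Obj.{u}) : ∀ᵐ ω : ℝ, ∀ x, act (inl A U) ω x = pair x 0 := by
  filter_upwards [act_comp (ρ_ A).inv (𝟙 A ⊗ₘ zero (𝟙_ Obj) U),
    act_tensorHom (𝟙 A) (zero (𝟙_ Obj) U), act_rightUnitor_inv A, act_id A,
    act_zero (𝟙_ Obj) U] with ω h1 h2 h3 h4 h5 x
  rw [inl, h1, h3, h2, h4, h5]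

lemma act_inr (A U : Obj.{u}) : ∀ᵐ ω : ℝ, ∀ x, act (inr A U) ω x = pair 0 x := by
  filter_upwards [act_comp (λ_ U).inv (zero (𝟙_ Obj) A ⊗ₘ 𝟙 U),
    act_tensorHom (zero (𝟙_ Obj) A) (𝟙 U), act_leftUnitor_inv U, act_id U,
    act_zero (𝟙_ Obj) A] with ω h1 h2 h3 h4 h5 x
  rw [inr, h1, h3, h2, h4, h5]

end Act

/-! ### The path sum as the solution of the feedback equation -/

section Feedback

variable {A B U : Obj.{u}}

/-- The block `ℂ^A → ℂ^B` of `f : A ⊕ U → B ⊕ U` at the frequency `ω`. -/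
noncomputable def blockBA (f : A ⊗ U ⟶ B ⊗ U) (ω : ℝ) : Matrix B A ℂ :=
  fun b a => evalAt f.hat ω (Sum.inl b) (Sum.inl a)

/-- The block `ℂ^U → ℂ^B` of `f : A ⊕ U → B ⊕ U` at the frequency `ω`. -/
noncomputable def blockBU (f : A ⊗ U ⟶ B ⊗ U) (ω : ℝ) : Matrix B U ℂ :=
  fun b u => evalAt f.hat ω (Sum.inl b) (Sum.inr u)

/-- The block `ℂ^A → ℂ^U` of `f : A ⊕ U → B ⊕ U` at the frequency `ω`. -/
noncomputable def blockUA (f : A ⊗ U ⟶ B ⊗ U) (ω : ℝ) : Matrix U A ℂ :=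
  fun u a => evalAt f.hat ω (Sum.inr u) (Sum.inl a)

/-- The block `ℂ^U → ℂ^U` of `f : A ⊕ U → B ⊕ U` at the frequency `ω`. -/
noncomputable def blockUU (f : A ⊗ U ⟶ B ⊗ U) (ω : ℝ) : Matrix U U ℂ :=
  fun u u' => evalAt f.hat ω (Sum.inr u) (Sum.inr u')

lemma evalAt_eq_fromBlocks (f : A ⊗ U ⟶ B ⊗ U) (ω : ℝ) :
    evalAt f.hat ω = Matrix.fromBlocks (blockBA f ω) (blockBU f ω) (blockUA f ω) (blockUU f ω) :=
  (Matrix.fromBlocks_toBlocks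
    (evalAt f.hat ω : Matrix (B.carrier ⊕ U.carrier) (A.carrier ⊕ U.carrier) ℂ)).symm

lemma act_pair (f : A ⊗ U ⟶ B ⊗ U) (ω : ℝ) (x : A → ℂ) (u : U → ℂ) :
    act f ω (pair x u) = pair ((blockBA f ω).mulVec x + (blockBU f ω).mulVec u)
      ((blockUA f ω).mulVec x + (blockUU f ω).mulVec u) := by
  rw [act, evalAt_eq_fromBlocks]
  exact Matrix.fromBlocks_mulVec _ _ _ _ (Sum.elim x u)

lemma act_compBA (f : A ⊗ U ⟶ B ⊗ U) :
    ∀ᵐ ω : ℝ, ∀ x, act (compBA f) ω x = (blockBA f ω).mulVec x := by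
  filter_upwards [act_comp (inl A U) (f ≫ fst B U), act_comp f (fst B U), act_inl A U,
    act_fst B U] with ω h1 h2 h3 h4 x
  rw [compBA, h1, h2, h3, act_pair, h4]; simp

lemma act_compBU (f : A ⊗ U ⟶ B ⊗ U) :
    ∀ᵐ ω : ℝ, ∀ x, act (compBU f) ω x = (blockBU f ω).mulVec x := by
  filter_upwards [act_comp (inr A U) (f ≫ fst B U), act_comp f (fst B U), act_inr A U,
    act_fst B U] with ω h1 h2 h3 h4 x
  rw [compBU, h1, h2, h3, act_pair, h4]; simp

lemma act_compUA (f : A ⊗ U ⟶ B ⊗ U) :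
    ∀ᵐ ω : ℝ, ∀ x, act (compUA f) ω x = (blockUA f ω).mulVec x := by
  filter_upwards [act_comp (inl A U) (f ≫ snd B U), act_comp f (snd B U), act_inl A U,
    act_snd B U] with ω h1 h2 h3 h4 x
  rw [compUA, h1, h2, h3, act_pair, h4]; simp

lemma act_compUU (f : A ⊗ U ⟶ B ⊗ U) :
    ∀ᵐ ω : ℝ, ∀ x, act (compUU f) ω x = (blockUU f ω).mulVec x := by
  filter_upwards [act_comp (inr A U) (f ≫ snd B U), act_comp f (snd B U), act_inr A U,
    act_snd B U] with ω h1 h2 h3 h4 x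
  rw [compUU, h1, h2, h3, act_pair, h4]; simp

lemma act_iter (f : A ⊗ U ⟶ B ⊗ U) (n : ℕ) :
    ∀ᵐ ω : ℝ, ∀ x, act (iter (compUU f) n) ω x = (blockUU f ω ^ n).mulVec x := by
  induction n with
  | zero =>
    filter_upwards [act_id U] with ω h x
    rw [iter, h, pow_zero, Matrix.one_mulVec]
  | succ n ih =>
    filter_upwards [ih, act_comp (iter (compUU f) n) (compUU f), act_compUU f] with ω h1 h2 h3 x
    rw [pow_succ', iter, h2, h3, h1, Matrix.mulVec_mulVec]

/-- The sum over all paths, applied to a vector, is the output of a solution of the feedback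
equation. -/
lemma exists_act_eq_pair (f : A ⊗ U ⟶ B ⊗ U) : ∀ᵐ ω : ℝ, ∀ x, ∃ y u,
    act f ω (pair x u) = pair y u ∧ HasSum (fun i => act (paths f i) ω x) y := by
  filter_upwards [f.contraction, act_compBA f, act_compBU f, act_compUA f,
    ae_all_iff.2 (act_iter f),
    ae_all_iff.2 fun n => act_comp (compUA f) (iter (compUU f) n ≫ compBU f),
    ae_all_iff.2 fun n => act_comp (iter (compUU f) n) (compBU f)]
    with ω hf hBA hBU hUA hit hc1 hc2 x
  have hf' : IsContraction (Matrix.fromBlocks (blockBA f ω) (blockBU f ω) (blockUA f ω)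
      (blockUU f ω)) := by
    rw [← evalAt_eq_fromBlocks]; exact hf
  obtain ⟨u, hu, hs⟩ := hf'.exists_feedback x
  refine ⟨(blockBA f ω).mulVec x + (blockBU f ω).mulVec u, u, by rw [act_pair, hu], ?_⟩
  have h1 : HasSum ((fun i => act (paths f i) ω x) ∘ Sum.inl) ((blockBA f ω).mulVec x) := by
    have : ((fun i => act (paths f i) ω x) ∘ Sum.inl) = fun _ : Unit => (blockBA f ω).mulVec x :=
      funext fun _ => hBA x
    rw [this]
    exact hasSum_unique _
  have h2 : HasSum ((fun i => act (paths f i) ω x) ∘ Sum.inr) ((blockBU f ω).mulVec u) := by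
    refine hs.congr_fun ?_
    intro n
    simp only [Function.comp_apply, paths, Sum.elim_inr, hc1, hc2, hit, hUA, hBU]
  exact h1.sum h2

/-- By linearity `f` sends `(0, u - u')` to `(y - y', u - u')`; the loop energies cancel in the
contraction inequality and leave `‖y - y'‖² ≤ 0`. The loop vectors themselves may differ. -/
lemma eq_of_act_eq_pair {f : A ⊗ U ⟶ B ⊗ U} {ω : ℝ} (hf : IsContraction (evalAt f.hat ω))
    {x : A → ℂ} {y y' : B → ℂ} {u u' : U → ℂ} (h : act f ω (pair x u) = pair y u)
    (h' : act f ω (pair x u') = pair y' u') : y = y' := by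
  have hsub : act f ω (pair 0 (u - u')) = pair (y - y') (u - u') := by
    have e : ∀ {B : Obj.{u}} (x x' : B → ℂ) (u u' : U → ℂ),
        pair x u - pair x' u' = pair (x - x') (u - u') := by
      intro B x x' u u'
      funext i
      rcases i with i | i <;> rfl
    rw [← e, ← h, ← h', act, act, act, ← Matrix.mulVec_sub, e, sub_self]
  have hle := (isContraction_iff _).1 hf (pair 0 (u - u'))
  change ∑ i, ‖act f ω (pair 0 (u - u')) i‖ ^ 2 ≤ _ at hle
  rw [hsub, sum_pair, sum_pair] at hle
  have h0 : ∑ b, ‖(y - y') b‖ ^ 2 = 0 :=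
    le_antisymm (by simpa using hle) (Finset.sum_nonneg fun _ _ => by positivity)
  rw [Finset.sum_eq_zero_iff_of_nonneg fun _ _ => by positivity] at h0
  funext b
  simpa [sub_eq_zero] using h0 b (Finset.mem_univ b)

/-- Entries are values on basis vectors, so vectorwise convergence is entrywise convergence.
Linearity of `y` is not assumed; it follows from uniqueness of limits. -/
lemma hasSum_of_hasSum_mulVec {ι : Type v} {M : ι → Matrix B A ℂ} {y : (A → ℂ) → B → ℂ}
    (h : ∀ x, HasSum (fun i => (M i).mulVec x) (y x)) :
    ∃ E : Matrix B A ℂ, HasSum M E ∧ ∀ x, E.mulVec x = y x := by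
  have hE : HasSum M (Matrix.of fun b a => y (Pi.single a 1) b) := by
    refine Pi.hasSum.2 fun b => Pi.hasSum.2 fun a => ?_
    have := Pi.hasSum.1 (h (Pi.single a 1)) b
    simpa using this
  refine ⟨_, hE, fun x => HasSum.unique ?_ (h x)⟩
  exact hE.map (Matrix.mulVec.addMonoidHomLeft x) (by
    exact Continuous.matrix_mulVec continuous_id continuous_const)

/-- `g` sends every input of `f` with feedback along `U` to the corresponding output. -/
def IsFeedback (f : A ⊗ U ⟶ B ⊗ U) (g : A ⟶ B) : Prop :=
  ∀ᵐ ω : ℝ, ∀ x, ∃ u, act f ω (pair x u) = pair (act g ω x) u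

lemma exists_hasSum_paths (f : A ⊗ U ⟶ B ⊗ U) : ∀ᵐ ω : ℝ, ∃ E : Matrix B A ℂ,
    HasSum (fun i => evalAt (paths f i).hat ω) E ∧
      ∀ x, ∃ u, act f ω (pair x u) = pair (E.mulVec x) u := by
  filter_upwards [exists_act_eq_pair f] with ω h
  choose y u hu hs using h
  obtain ⟨E, hE, hEy⟩ := hasSum_of_hasSum_mulVec hs
  exact ⟨E, hE, fun x => ⟨u x, by rw [hEy]; exact hu x⟩⟩

/-- The path sum exists and is an output of the loop; outputs are unique, so any morphism with the
feedback property agrees with it. This trades series for a single equation. -/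
lemma isSum_paths_iff (f : A ⊗ U ⟶ B ⊗ U) (g : A ⟶ B) : IsSum (paths f) g ↔ IsFeedback f g := by
  constructor
  · intro h
    filter_upwards [h, exists_hasSum_paths f] with ω h ⟨E, hE, hu⟩
    rw [hE.unique h] at hu
    exact hu
  · intro h
    filter_upwards [h, exists_hasSum_paths f, f.contraction] with ω h ⟨E, hE, hu⟩ hf
    have : E = evalAt g.hat ω := by
      refine Matrix.ext_of_mulVec_single fun a => ?_
      obtain ⟨u, h1⟩ := hu (Pi.single a 1)
      obtain ⟨u', h2⟩ := h (Pi.single a 1)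
      exact eq_of_act_eq_pair hf h1 h2
    rwa [this] at hE

lemma IsSum.unique {ι : Type v} [Countable ι] {f : ι → (A ⟶ B)} {g g' : A ⟶ B}
    (h : IsSum f g) (h' : IsSum f g') : g = g' := by
  refine hom_ext fun b a => AEEqFun.ext ?_
  filter_upwards [h, h'] with ω h1 h2
  exact congr_fun (congr_fun (h1.unique h2) b) a

lemma IsFeedback.unique {f : A ⊗ U ⟶ B ⊗ U} {g g' : A ⟶ B} (h : IsFeedback f g)
    (h' : IsFeedback f g') : g = g' :=
  ((isSum_paths_iff f g).2 h).unique ((isSum_paths_iff f g').2 h')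

lemma IsContraction.norm_apply_le_one {M : Matrix B A ℂ} (h : IsContraction M) (b : B) (a : A) :
    ‖M b a‖ ≤ 1 := by
  have h1 := (isContraction_iff _).1 h (Pi.single a 1)
  have h2 : ∑ a', ‖(Pi.single a 1 : A → ℂ) a'‖ ^ 2 = 1 := by
    rw [Finset.sum_eq_single a] <;> simp +contextual
  rw [h2] at h1
  have h3 := (Finset.single_le_sum (f := fun b => ‖(M.mulVec (Pi.single a 1)) b‖ ^ 2)
    (fun _ _ => by positivity) (Finset.mem_univ b)).trans h1
  simpa using h3

lemma coeFn_sum_ae {ι : Type v} (s : Finset ι) (m : ι → Freq) :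
    ∀ᵐ ω : ℝ, (∑ i ∈ s, m i : Freq) ω = ∑ i ∈ s, m i ω := by
  classical
  induction s using Finset.induction_on with
  | empty =>
    filter_upwards [AEEqFun.coeFn_zero (α := ℝ) (β := ℂ) (μ := volume)] with ω h
    simp [h]
  | insert i s hi ih =>
    filter_upwards [ih, AEEqFun.coeFn_add (m i) (∑ i ∈ s, m i)] with ω h1 h2
    rw [Finset.sum_insert hi, Finset.sum_insert hi, h2, Pi.add_apply, h1]

/-- The sum over all paths is a morphism. -/
lemma exists_isFeedback (f : A ⊗ U ⟶ B ⊗ U) : ∃ g : A ⟶ B, IsFeedback f g := by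
  let E : ℝ → Matrix B A ℂ := fun ω => ∑' i, evalAt (paths f i).hat ω
  have hE : ∀ᵐ ω : ℝ, HasSum (fun i => evalAt (paths f i).hat ω) (E ω) ∧
      ∀ x, ∃ u, act f ω (pair x u) = pair ((E ω).mulVec x) u := by
    filter_upwards [exists_hasSum_paths f] with ω ⟨E', h, hu⟩
    have : E ω = E' := h.tsum_eq
    rw [this]; exact ⟨h, hu⟩
  have hcontr : ∀ᵐ ω : ℝ, IsContraction (E ω) := by
    filter_upwards [hE, f.contraction] with ω h hf
    refine (isContraction_iff _).2 fun x => ?_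
    obtain ⟨u, hu⟩ := h.2 x
    have hle := (isContraction_iff _).1 hf (pair x u)
    change ∑ i, ‖act f ω (pair x u) i‖ ^ 2 ≤ _ at hle
    rw [hu, sum_pair, sum_pair] at hle
    -- The loop energy `‖u‖²` occurs on both sides and cancels.
    exact le_of_add_le_add_right hle
  -- The limit theorem for symbols needs a sequence; by unconditional convergence any enumeration of
  -- the paths serves.
  let e : ℕ ≃ Unit ⊕ ℕ := Equiv.natSumPUnitEquivNat.symm.trans (Equiv.sumComm ℕ Unit)
  have hentry : ∀ (b : B) (a : A), ∃ m : Freq, IsEntry m ∧ m =ᵐ[volume] fun ω => E ω b a := by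
    intro b a
    refine IsEntry.exists_of_tendsto (C := 1)
      (m := fun n => ∑ k ∈ Finset.range n, (paths f (e k)).hat b a)
      (fun n => IsEntry.sum _ fun k => (exists_lsi_iff _).1 (paths f (e k)).exists_lsi b a) ?_ ?_
    · filter_upwards [hE, ae_all_iff.2 fun n => coeFn_sum_ae (Finset.range n)
        fun k => (paths f (e k)).hat b a] with ω h1 h2
      have h3 := (e.hasSum_iff.2 (Pi.hasSum.1 (Pi.hasSum.1 h1.1 b) a)).tendsto_sum_nat
      exact h3.congr fun n => (h2 n).symm
    · filter_upwards [hcontr] with ω h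
      exact h.norm_apply_le_one b a
  choose m hm hmE using hentry
  have heval : ∀ᵐ ω : ℝ, evalAt (Matrix.of m) ω = E ω := by
    filter_upwards [ae_all_iff.2 fun b => ae_all_iff.2 fun a => hmE b a] with ω h
    ext b a
    exact h b a
  refine ⟨⟨Matrix.of m, (exists_lsi_iff _).2 hm, ?_⟩, ?_⟩
  · filter_upwards [heval, hcontr] with ω h1 h2
    rwa [h1]
  · filter_upwards [heval, hE] with ω h1 h2 x
    change ∃ u, act f ω (pair x u) = pair ((evalAt (Matrix.of m) ω).mulVec x) u
    rw [h1]; exact h2.2 x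

/-! ### The execution and the trace axioms -/

/-- The execution `ex^U(f)`. -/
noncomputable def ex (A B U : Obj.{u}) (f : A ⊗ U ⟶ B ⊗ U) : A ⟶ B :=
  (exists_isFeedback f).choose

lemma isFeedback_ex (f : A ⊗ U ⟶ B ⊗ U) : IsFeedback f (ex A B U f) :=
  (exists_isFeedback f).choose_spec

lemma IsFeedback.eq_ex {f : A ⊗ U ⟶ B ⊗ U} {g : A ⟶ B} (h : IsFeedback f g) :
    g = ex A B U f :=
  h.unique (isFeedback_ex f)

end Feedback

/-- Since feedback determines the output, each axiom only needs a loop vector for one side, built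
from those of the other: the same vector for naturality and superposing, the pair of both for nested
loops, the input itself for yanking. -/
lemma isTrace_ex : IsTrace ex.{u} where
  naturality {A A' B B' U} g f h := by
    refine IsFeedback.eq_ex ?_
    filter_upwards [isFeedback_ex f, act_comp g (ex A B U f ≫ h), act_comp (ex A B U f) h,
      act_comp (g ▷ U) (f ≫ h ▷ U), act_comp f (h ▷ U), act_whiskerRight g U,
      act_whiskerRight h U] with ω h1 h2 h3 h4 h5 h6 h7 x
    obtain ⟨u, hu⟩ := h1 (act g ω x)
    exact ⟨u, by rw [h4, h5, h6, hu, h7, h2, h3]⟩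
  dinaturality {A B U U'} f g := by
    refine IsFeedback.eq_ex ?_
    filter_upwards [isFeedback_ex (f ≫ B ◁ g), act_comp f (B ◁ g), act_comp (A ◁ g) f,
      act_whiskerLeft B g, act_whiskerLeft A g] with ω h1 h2 h3 h4 h5 x
    obtain ⟨u, hu⟩ := h1 x
    obtain ⟨y, w, hyw⟩ := exists_pair (act f ω (pair x u))
    rw [h2, hyw, h4] at hu
    obtain ⟨hy, hw⟩ := pair_inj hu
    -- Cutting the loop before `g` instead of after it: `w` is the signal entering `g`, and `g w =
    -- u`.
    exact ⟨w, by rw [h3, h5, hw, hyw, hy]⟩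
  superposing {A B D E U} g f := by
    refine IsFeedback.eq_ex ?_
    filter_upwards [isFeedback_ex f, act_comp (α_ D A U).hom ((g ⊗ₘ f) ≫ (α_ E B U).inv),
      act_comp (g ⊗ₘ f) (α_ E B U).inv, act_associator_hom D A U, act_associator_inv E B U,
      act_tensorHom g f, act_tensorHom g (ex A B U f)] with ω h1 h2 h3 h4 h5 h6 h7 z
    obtain ⟨z, x, rfl⟩ := exists_pair z
    obtain ⟨u, hu⟩ := h1 x
    exact ⟨u, by rw [h2, h3, h4, h6, hu, h5, h7]⟩
  vanishing_unit {A B} f := by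
    refine (IsFeedback.eq_ex ?_).symm
    filter_upwards [act_comp (ρ_ A).inv (f ≫ (ρ_ B).hom), act_comp f (ρ_ B).hom,
      act_rightUnitor_inv A, act_rightUnitor_hom B] with ω h1 h2 h3 h4 x
    obtain ⟨y, w, hyw⟩ := exists_pair (act f ω (pair x 0))
    have hw : w = 0 := funext fun i => PEmpty.elim i
    exact ⟨0, by rw [h1, h2, h3, hyw, h4, hw]⟩
  vanishing_tensor {A B U V} f := by
    refine IsFeedback.eq_ex ?_
    filter_upwards [isFeedback_ex f, isFeedback_ex (ex (A ⊗ U) (B ⊗ U) V f),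
      act_comp (α_ A U V).inv (f ≫ (α_ B U V).hom), act_comp f (α_ B U V).hom,
      act_associator_inv A U V, act_associator_hom B U V] with ω h1 h2 h3 h4 h5 h6 x
    obtain ⟨u, hu⟩ := h2 x
    obtain ⟨v, hv⟩ := h1 (pair x u)
    exact ⟨pair u v, by rw [h3, h4, h5, hv, hu, h6]⟩
  yanking U := by
    refine (IsFeedback.eq_ex ?_).symm
    filter_upwards [act_braiding_hom U U, act_id U] with ω h1 h2 x
    exact ⟨x, by rw [h1, h2]⟩

end LSI

/-- Every `f : A ⊕ U → B ⊕ U` has exactly one sum `ex^U(f)` of the family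
`{f_BA} ⊎ {f_BU f_UU^n f_UA}`, these form a trace on `LSI_≤`, and every linear shift invariant map
represented by `ex^U(f)` is a contraction. -/
theorem mainTheorem1 :
    ∃ ex : ∀ A B U : LSI.Obj.{u}, (A ⊗ U ⟶ B ⊗ U) → (A ⟶ B),
      (∀ (A B U : LSI.Obj.{u}) (f : A ⊗ U ⟶ B ⊗ U) (g : A ⟶ B),
        LSI.IsSum (LSI.paths f) g ↔ g = ex A B U f) ∧
      LSI.IsTrace ex ∧
      (∀ (A B U : LSI.Obj.{u}) (f : A ⊗ U ⟶ B ⊗ U)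
        (D : LSI.SumEllTwo A →L[ℂ] LSI.SumEllTwo B),
        LSI.IsLSI D → LSI.hatOf D = (ex A B U f).hat → ∀ Ψ, ‖D Ψ‖ ≤ ‖Ψ‖) := by
  refine ⟨LSI.ex, fun A B U f g => ?_, LSI.isTrace_ex, fun A B U f D hD hhat Ψ => ?_⟩
  · rw [LSI.isSum_paths_iff]
    exact ⟨fun h => h.eq_ex, fun h => h ▸ LSI.isFeedback_ex f⟩
  · exact hD.norm_apply_le (hhat ▸ (LSI.ex A B U f).contraction) Ψ
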